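/- All algebras are associative complex algebras, not necessarily unital, with non-degenerate product ($ab=0$ for all $b$ implies $a=0$, and $ba=0$ for all $b$ implies $a=0$). $M(A)$ denotes the multiplier algebra, $\iota$ the identity map, $m:A\otimes A\to A$ the multiplication, and $A\otimes A$ is regarded as a subalgebra of $M(A\otimes A)$. A comultiplication on $A$ is a linear map $\Delta:A\to M(A\otimes A)$ such that $\Delta(a)(1\otimes b)$ and $(a\otimes 1)\Delta(b)$ lie in $A\otimes A$ and $(a\otimes1\otimes1)(\Delta\otimes\iota)(\Delta(b)(1\otimes c))=(\iota\otimes\Delta)((a\otimes1)\Delta(b))(1\otimes1\otimes c)$ for all $a,b,c\in A$. It is regular if also $\Delta(a)(b\otimes1)$ and $(1\otimes a)\Delta(b)$ lie in $A\otimes A$ for all $a,b$. A counit is a homomorphism $\varepsilon:A\to\mathbb C$ with $(\varepsilon\otimes\iota)\Delta(a)=a=(\iota\otimes\varepsilon)\Delta(a)$ in $M(A)$ for all $a$. A left integral is a non-zero linear functional $\varphi$ on $A$ with $(\iota\otimes\varphi)\Delta(a)=\varphi(a)1$ in $M(A)$ for all $a$. A linear functional $f$ is faithful if $a=0$ whenever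 $f(ab)=0$ for all $b$ or $f(ba)=0$ for all $b$. Given a faithful left integral $\varphi$, an antipode relative to $\varphi$ is a bijective linear anti-homomorphism $S:A\to A$ with $$S((\iota\otimes\varphi)(\Delta(a)(1\otimes b)))=(\iota\otimes\varphi)((1\otimes a)\Delta(b))\qquad(a,b\in A).\tag{1}$$ An algebraic quantum hypergroup is a pair $(A,\Delta)$ with $\Delta$ a regular comultiplication for which there exist a counit and a faithful left integral $\varphi$ with an antipode relative to $\varphi$. A multiplier Hopf algebra is a pair $(A,\Delta)$ with $\Delta$ a comultiplication that is an algebra homomorphism and such that $a\otimes b\mapsto\Delta(a)(1\otimes b)$ and $a\otimes b\mapsto(a\otimes1)\Delta(b)$ define bijections from $A\otimes A$ onto $A\otimes A$. It is regular if $(A,\Delta^{\rm op})$, with $\Delta^{\rm op}$ the composition of $\Delta$ with the flip, is also a multiplier Hopf algebra. An algebraic quantum group (in the sense of Van Daele) is a regular multiplier Hopf algebra that admits a left integral. By an antipode of an algebraic quantum group with counit $\varepsilon$ we mean a linear map $S:A\to A$ with $m((S\otimes\iota)(\Delta(a)(1\otimes b)))=\varepsilon(a)b$ and $m((\iota\otimes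 S)((a\otimes1)\Delta(b)))=\varepsilon(b)a$ for all $a,b\in A$. **Proposition 1.14.** Every algebraic quantum group $(A,\Delta)$ is an algebraic quantum hypergroup. More precisely, $(A,\Delta)$ has a counit $\varepsilon$ and an antipode $S$; and for every counit $\varepsilon$, every antipode $S$ and every left integral $\varphi$, the functional $\varphi$ is faithful and $S$ is an antipode relative to $\varphi$, i.e. $S$ is a bijective anti-homomorphism and (1) holds for all $a,b\in A$. -/

import Mathlib

open scoped TensorProduct

noncomputable section

namespace QHyper

/-! Throughout, an algebra is an associative complex algebra, not necessarily unital. -/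

section Multipliers

variable (B : Type*) [NonUnitalRing B] [Module ℂ B] [IsScalarTower ℂ B B] [SMulCommClass ℂ B B]

/-- The product of `B` is non-degenerate (as a bilinear map). -/
structure NondegenerateMul (B : Type*) [NonUnitalRing B] : Prop where
  eq_zero_of_mul_right : ∀ a : B, (∀ b : B, a * b = 0) → a = 0
  eq_zero_of_mul_left : ∀ a : B, (∀ b : B, b * a = 0) → a = 0

/-- The multiplier algebra `M(B)`, as the algebra of double centralizers: pairs `(L, R)` where `L`
is a left multiplier (`L x` plays the role of `m x`), `R` is a right multiplier (`R x` plays the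
role of `x m`) and `(x m) y = x (m y)`. -/
def multiplierSubalgebra : Subalgebra ℂ (Module.End ℂ B × (Module.End ℂ B)ᵐᵒᵖ) where
  carrier := {p | (∀ x y, p.1 (x * y) = p.1 x * y) ∧
    (∀ x y, p.2.unop (x * y) = x * p.2.unop y) ∧ ∀ x y, p.2.unop x * y = x * p.1 y}
  mul_mem' := by
    rintro p q ⟨h1, h2, h3⟩ ⟨k1, k2, k3⟩
    refine ⟨fun x y => ?_, fun x y => ?_, fun x y => ?_⟩
    · simp [h1, k1]
    · simp [h2, k2]
    · simp [h3, k3]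
  add_mem' := by
    rintro p q ⟨h1, h2, h3⟩ ⟨k1, k2, k3⟩
    refine ⟨fun x y => ?_, fun x y => ?_, fun x y => ?_⟩
    · simp [h1, k1, add_mul]
    · simp [h2, k2, mul_add]
    · simp [h3, k3, add_mul, mul_add]
  algebraMap_mem' := by
    intro r
    refine ⟨fun x y => ?_, fun x y => ?_, fun x y => ?_⟩ <;>
      simp [Algebra.algebraMap_eq_smul_one, smul_mul_assoc, mul_smul_comm]

/-- The multiplier algebra `M(B)`. -/
abbrev Multiplier : Type _ := multiplierSubalgebra B

variable {B}

/-- `m.lmul x` is the product `m x`. -/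
def Multiplier.lmul (m : Multiplier B) : B →ₗ[ℂ] B := m.1.1

/-- `m.rmul x` is the product `x m`. -/
def Multiplier.rmul (m : Multiplier B) : B →ₗ[ℂ] B := m.1.2.unop

/-- A multiplier from its two actions. -/
def Multiplier.mk (L R : B →ₗ[ℂ] B) (hL : ∀ x y, L (x * y) = L x * y)
    (hR : ∀ x y, R (x * y) = x * R y) (h : ∀ x y, R x * y = x * L y) : Multiplier B :=
  ⟨(L, MulOpposite.op R), hL, hR, h⟩

theorem Multiplier.lmul_mul (m : Multiplier B) (x y : B) : m.lmul (x * y) = m.lmul x * y :=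
  m.2.1 x y

theorem Multiplier.rmul_mul (m : Multiplier B) (x y : B) : m.rmul (x * y) = x * m.rmul y :=
  m.2.2.1 x y

theorem Multiplier.central (m : Multiplier B) (x y : B) : m.rmul x * y = x * m.lmul y :=
  m.2.2.2 x y

theorem Multiplier.ext {m n : Multiplier B} (h : ∀ x, m.lmul x = n.lmul x)
    (k : ∀ x, m.rmul x = n.rmul x) : m = n :=
  Subtype.ext (Prod.ext (LinearMap.ext h) (MulOpposite.unop_injective (LinearMap.ext k)))

variable (B) in
/-- The canonical map `B → M(B)`, sending `b` to left and right multiplication by `b`. -/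
def toMultiplier : B →ₗ[ℂ] Multiplier B where
  toFun b := Multiplier.mk (LinearMap.mulLeft ℂ b) (LinearMap.mulRight ℂ b)
    (fun x y => by simp [mul_assoc]) (fun x y => by simp [mul_assoc])
    (fun x y => by simp [mul_assoc])
  map_add' a b := Multiplier.ext (fun x => add_mul a b x) (fun x => mul_add x a b)
  map_smul' r b := Multiplier.ext (fun x => smul_mul_assoc r b x) (fun x => mul_smul_comm r x b)

/-- The multiplier `m` belongs to `B`. -/
def Multiplier.IsInAlgebra (m : Multiplier B) : Prop := ∃ b : B, toMultiplier B b = m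

open Classical in
/-- A multiplier which belongs to `B`, viewed as an element of `B` (and `0` if it does not belong
to `B`). The element is unique as soon as the product of `B` is non-degenerate. -/
def Multiplier.toAlgebra (m : Multiplier B) : B :=
  if h : m.IsInAlgebra then h.choose else 0

variable {C : Type*} [NonUnitalRing C] [Module ℂ C] [IsScalarTower ℂ C C] [SMulCommClass ℂ C C]

/-- The extension of an algebra isomorphism `B ≃ C` to the multiplier algebras. -/
def Multiplier.congr (e : B ≃ₗ[ℂ] C) (he : ∀ x y, e (x * y) = e x * e y) :
    Multiplier B →ₗ[ℂ] Multiplier C where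
  toFun m := Multiplier.mk (e.toLinearMap ∘ₗ m.lmul ∘ₗ e.symm.toLinearMap)
    (e.toLinearMap ∘ₗ m.rmul ∘ₗ e.symm.toLinearMap)
    (fun x y => by
      obtain ⟨x, rfl⟩ := e.surjective x
      obtain ⟨y, rfl⟩ := e.surjective y
      simp [← he, m.lmul_mul])
    (fun x y => by
      obtain ⟨x, rfl⟩ := e.surjective x
      obtain ⟨y, rfl⟩ := e.surjective y
      simp [← he, m.rmul_mul])
    (fun x y => by
      obtain ⟨x, rfl⟩ := e.surjective x
      obtain ⟨y, rfl⟩ := e.surjective y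
      simp [← he, m.central])
  map_add' m n := Multiplier.ext (fun _ => map_add e _ _) (fun _ => map_add e _ _)
  map_smul' r m := Multiplier.ext (fun _ => map_smul e r _) (fun _ => map_smul e r _)

/-- The tensor product of two multipliers `m ∈ M(B)`, `n ∈ M(C)` as an element of `M(B ⊗ C)`. -/
def Multiplier.tensor (m : Multiplier B) (n : Multiplier C) : Multiplier (B ⊗[ℂ] C) :=
  Multiplier.mk (TensorProduct.map m.lmul n.lmul) (TensorProduct.map m.rmul n.rmul)
    (fun x y => by
      induction x with
      | zero => simp
      | add x x' hx hx' => simp [add_mul, hx, hx']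
      | tmul b c =>
        induction y with
        | zero => simp
        | add y y' hy hy' => simp [mul_add, hy, hy']
        | tmul b' c' => simp [m.lmul_mul, n.lmul_mul])
    (fun x y => by
      induction x with
      | zero => simp
      | add x x' hx hx' => simp [add_mul, hx, hx']
      | tmul b c =>
        induction y with
        | zero => simp
        | add y y' hy hy' => simp [mul_add, hy, hy']
        | tmul b' c' => simp [m.rmul_mul, n.rmul_mul])
    (fun x y => by
      induction x with
      | zero => simp
      | add x x' hx hx' => simp [add_mul, hx, hx']
      | tmul b c =>
        induction y with
        | zero => simp
        | add y y' hy hy' => simp only [mul_add, map_add, hy, hy']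
        | tmul b' c' => simp [m.central, n.central])

variable (B C) in
/-- The bilinear map `M(B) × M(C) → M(B ⊗ C)`, `(m, n) ↦ m ⊗ n`. -/
def Multiplier.tensorₗ : Multiplier B →ₗ[ℂ] Multiplier C →ₗ[ℂ] Multiplier (B ⊗[ℂ] C) :=
  LinearMap.mk₂ ℂ Multiplier.tensor
    (fun m m' n => Multiplier.ext
      (fun x => LinearMap.congr_fun (TensorProduct.map_add_left m.lmul m'.lmul n.lmul) x)
      (fun x => LinearMap.congr_fun (TensorProduct.map_add_left m.rmul m'.rmul n.rmul) x))
    (fun r m n => Multiplier.ext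
      (fun x => LinearMap.congr_fun (TensorProduct.map_smul_left r m.lmul n.lmul) x)
      (fun x => LinearMap.congr_fun (TensorProduct.map_smul_left r m.rmul n.rmul) x))
    (fun m n n' => Multiplier.ext
      (fun x => LinearMap.congr_fun (TensorProduct.map_add_right m.lmul n.lmul n'.lmul) x)
      (fun x => LinearMap.congr_fun (TensorProduct.map_add_right m.rmul n.rmul n'.rmul) x))
    (fun r m n => Multiplier.ext
      (fun x => LinearMap.congr_fun (TensorProduct.map_smul_right r m.lmul n.lmul) x)
      (fun x => LinearMap.congr_fun (TensorProduct.map_smul_right r m.rmul n.rmul) x))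

end Multipliers

section Comultiplications

variable {A : Type*} [NonUnitalRing A] [Module ℂ A] [IsScalarTower ℂ A A] [SMulCommClass ℂ A A]

/-- The multiplier `a ⊗ 1` of `A ⊗ A`. -/
def leg₁ (a : A) : Multiplier (A ⊗[ℂ] A) := (toMultiplier A a).tensor 1

/-- The multiplier `1 ⊗ b` of `A ⊗ A`. -/
def leg₂ (b : A) : Multiplier (A ⊗[ℂ] A) := (1 : Multiplier A).tensor (toMultiplier A b)

/-- The flip `a ⊗ b ↦ b ⊗ a`, extended to `M(A ⊗ A)`. -/
def flip : Multiplier (A ⊗[ℂ] A) →ₗ[ℂ] Multiplier (A ⊗[ℂ] A) :=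
  Multiplier.congr (TensorProduct.comm ℂ A A) (fun x y => by
    induction x with
    | zero => simp
    | add x x' hx hx' => simp [add_mul, hx, hx']
    | tmul b c =>
      induction y with
      | zero => simp
      | add y y' hy hy' => simp [mul_add, hy, hy']
      | tmul b' c' => simp)

/-- The identification of `M((A ⊗ A) ⊗ A)` with `M(A ⊗ (A ⊗ A))`. -/
def reassoc : Multiplier ((A ⊗[ℂ] A) ⊗[ℂ] A) →ₗ[ℂ] Multiplier (A ⊗[ℂ] (A ⊗[ℂ] A)) :=
  Multiplier.congr (TensorProduct.assoc ℂ A A A) (fun x y => by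
    induction x with
    | zero => simp
    | add x x' hx hx' => simp [add_mul, hx, hx']
    | tmul u c =>
      induction y with
      | zero => simp
      | add y y' hy hy' => simp [mul_add, hy, hy']
      | tmul v d =>
        induction u with
        | zero => simp
        | add u u' hu hu' => simp only [add_mul, TensorProduct.add_tmul, map_add, hu, hu']
        | tmul a b =>
          induction v with
          | zero => simp
          | add v v' hv hv' => simp only [mul_add, TensorProduct.add_tmul, map_add, hv, hv']
          | tmul a' b' => simp)

/-- The slice map `ι ⊗ ω : A ⊗ A → A`. -/
def sliceRight (ω : A →ₗ[ℂ] ℂ) : A ⊗[ℂ] A →ₗ[ℂ] A :=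
  (TensorProduct.rid ℂ A).toLinearMap ∘ₗ ω.lTensor A

/-- The slice map `ω ⊗ ι : A ⊗ A → A`. -/
def sliceLeft (ω : A →ₗ[ℂ] ℂ) : A ⊗[ℂ] A →ₗ[ℂ] A :=
  (TensorProduct.lid ℂ A).toLinearMap ∘ₗ ω.rTensor A

variable (Δ : A →ₗ[ℂ] Multiplier (A ⊗[ℂ] A))

/-- The map `Δ ⊗ ι : A ⊗ A → M((A ⊗ A) ⊗ A)`, `a ⊗ b ↦ Δ(a) ⊗ b`. -/
def comulTensorId : A ⊗[ℂ] A →ₗ[ℂ] Multiplier ((A ⊗[ℂ] A) ⊗[ℂ] A) :=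
  TensorProduct.lift ((Multiplier.tensorₗ (A ⊗[ℂ] A) A).compl₁₂ Δ (toMultiplier A))

/-- The map `ι ⊗ Δ : A ⊗ A → M(A ⊗ (A ⊗ A))`, `a ⊗ b ↦ a ⊗ Δ(b)`. -/
def idTensorComul : A ⊗[ℂ] A →ₗ[ℂ] Multiplier (A ⊗[ℂ] (A ⊗[ℂ] A)) :=
  TensorProduct.lift ((Multiplier.tensorₗ A (A ⊗[ℂ] A)).compl₁₂ (toMultiplier A) Δ)

/-- `Δ` is a comultiplication on `A` (not assumed to be multiplicative): `Δ(a)(1 ⊗ b)` and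
`(a ⊗ 1)Δ(b)` belong to `A ⊗ A`, and
`(a ⊗ 1 ⊗ 1) (Δ ⊗ ι)(Δ(b)(1 ⊗ c)) = (ι ⊗ Δ)((a ⊗ 1)Δ(b)) (1 ⊗ 1 ⊗ c)`. -/
structure IsComultiplication : Prop where
  mul_leg₂_mem : ∀ a b : A, (Δ a * leg₂ b).IsInAlgebra
  leg₁_mul_mem : ∀ a b : A, (leg₁ a * Δ b).IsInAlgebra
  coassoc : ∀ a b c : A,
    (toMultiplier A a).tensor (1 : Multiplier (A ⊗[ℂ] A)) *
        reassoc (comulTensorId Δ (Δ b * leg₂ c).toAlgebra) =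
      idTensorComul Δ (leg₁ a * Δ b).toAlgebra * (1 : Multiplier A).tensor (leg₂ c)

/-- A regular comultiplication: also `Δ(a)(b ⊗ 1)` and `(1 ⊗ a)Δ(b)` belong to `A ⊗ A`. -/
structure IsRegularComultiplication : Prop extends IsComultiplication Δ where
  mul_leg₁_mem : ∀ a b : A, (Δ a * leg₁ b).IsInAlgebra
  leg₂_mul_mem : ∀ a b : A, (leg₂ a * Δ b).IsInAlgebra

/-- The homomorphism `ε : A → ℂ` is a counit: `(ε ⊗ ι)Δ(a) = a = (ι ⊗ ε)Δ(a)`, equalities in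
`M(A)`. As usual, for `ω` a functional on `A`, the multiplier `(ω ⊗ ι)Δ(a)` is given by
`b ↦ (ω ⊗ ι)(Δ(a)(1 ⊗ b))` and `b ↦ (ω ⊗ ι)((1 ⊗ b)Δ(a))`, and similarly for `(ι ⊗ ω)Δ(a)`. -/
structure IsCounit (ε : A →ₗ[ℂ] ℂ) : Prop where
  map_mul : ∀ a b : A, ε (a * b) = ε a * ε b
  left_lmul : ∀ a b : A, sliceLeft ε (Δ a * leg₂ b).toAlgebra = a * b
  left_rmul : ∀ a b : A, sliceLeft ε (leg₂ b * Δ a).toAlgebra = b * a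
  right_lmul : ∀ a b : A, sliceRight ε (Δ a * leg₁ b).toAlgebra = a * b
  right_rmul : ∀ a b : A, sliceRight ε (leg₁ b * Δ a).toAlgebra = b * a

/-- The functional `φ` is a left integral: it is non-zero and `(ι ⊗ φ)Δ(a) = φ(a)1` in `M(A)`. -/
structure IsLeftIntegral (φ : A →ₗ[ℂ] ℂ) : Prop where
  ne_zero : φ ≠ 0
  lmul : ∀ a b : A, sliceRight φ (Δ a * leg₁ b).toAlgebra = φ a • b
  rmul : ∀ a b : A, sliceRight φ (leg₁ b * Δ a).toAlgebra = φ a • b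

/-- A faithful functional. -/
def IsFaithful (f : A →ₗ[ℂ] ℂ) : Prop :=
  ∀ a : A, ((∀ b : A, f (a * b) = 0) ∨ (∀ b : A, f (b * a) = 0)) → a = 0

/-- `S` is an antipode relative to `φ`: a bijective anti-homomorphism with
`S((ι ⊗ φ)(Δ(a)(1 ⊗ b))) = (ι ⊗ φ)((1 ⊗ a)Δ(b))`. -/
structure IsAntipodeRelativeTo (φ : A →ₗ[ℂ] ℂ) (S : A →ₗ[ℂ] A) : Prop where
  bijective : Function.Bijective S
  map_mul : ∀ a b : A, S (a * b) = S b * S a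
  apply_slice : ∀ a b : A,
    S (sliceRight φ (Δ a * leg₂ b).toAlgebra) = sliceRight φ (leg₂ a * Δ b).toAlgebra

/-- `(A, Δ)` is an algebraic quantum hypergroup. -/
structure IsAlgebraicQuantumHypergroup : Prop where
  nondegenerate : NondegenerateMul A
  comul : IsRegularComultiplication Δ
  exists_counit : ∃ ε : A →ₗ[ℂ] ℂ, IsCounit Δ ε
  exists_integral : ∃ φ : A →ₗ[ℂ] ℂ, IsLeftIntegral Δ φ ∧ IsFaithful φ ∧
    ∃ S : A →ₗ[ℂ] A, IsAntipodeRelativeTo Δ φ S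

/-- The map `a ⊗ b ↦ Δ(a)(1 ⊗ b)`, with values in `M(A ⊗ A)`. -/
def galois₁ : A ⊗[ℂ] A →ₗ[ℂ] Multiplier (A ⊗[ℂ] A) :=
  TensorProduct.lift ((LinearMap.mul ℂ (Multiplier (A ⊗[ℂ] A))).compl₁₂ Δ
    (Multiplier.tensorₗ A A 1 ∘ₗ toMultiplier A))

/-- The map `a ⊗ b ↦ (a ⊗ 1)Δ(b)`, with values in `M(A ⊗ A)`. -/
def galois₂ : A ⊗[ℂ] A →ₗ[ℂ] Multiplier (A ⊗[ℂ] A) :=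
  TensorProduct.lift ((LinearMap.mul ℂ (Multiplier (A ⊗[ℂ] A))).compl₁₂
    ((Multiplier.tensorₗ A A).flip 1 ∘ₗ toMultiplier A) Δ)

/-- `(A, Δ)` is a multiplier Hopf algebra: the product of `A` is non-degenerate, `Δ` is a
multiplicative comultiplication, and `a ⊗ b ↦ Δ(a)(1 ⊗ b)` and `a ⊗ b ↦ (a ⊗ 1)Δ(b)` are bijections
from `A ⊗ A` onto `A ⊗ A` (viewed in `M(A ⊗ A)`). -/
structure IsMultiplierHopfAlgebra : Prop where
  nondegenerate : NondegenerateMul A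
  comul : IsComultiplication Δ
  map_mul : ∀ a b : A, Δ (a * b) = Δ a * Δ b
  bijOn_galois₁ : Set.BijOn (galois₁ Δ) Set.univ (Set.range (toMultiplier (A ⊗[ℂ] A)))
  bijOn_galois₂ : Set.BijOn (galois₂ Δ) Set.univ (Set.range (toMultiplier (A ⊗[ℂ] A)))

/-- A multiplier Hopf algebra is regular if it is a multiplier Hopf algebra also for the opposite
comultiplication (the composition of `Δ` with the flip). -/
structure IsRegularMultiplierHopfAlgebra : Prop where
  hopf : IsMultiplierHopfAlgebra Δ
  hopf_op : IsMultiplierHopfAlgebra (flip ∘ₗ Δ)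

/-- An algebraic quantum group: a regular multiplier Hopf algebra with a left integral. -/
structure IsAlgebraicQuantumGroup : Prop where
  regular : IsRegularMultiplierHopfAlgebra Δ
  exists_integral : ∃ φ : A →ₗ[ℂ] ℂ, IsLeftIntegral Δ φ

/-- `S` is the antipode of a regular multiplier Hopf algebra with counit `ε`:
`m((S ⊗ ι)(Δ(a)(1 ⊗ b))) = ε(a)b` and `m((ι ⊗ S)((a ⊗ 1)Δ(b))) = ε(b)a`, where `m : A ⊗ A → A` is
the multiplication. -/
structure IsHopfAntipode (ε : A →ₗ[ℂ] ℂ) (S : A →ₗ[ℂ] A) : Prop where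
  left : ∀ a b : A,
    LinearMap.mul' ℂ A (S.rTensor A (Δ a * leg₂ b).toAlgebra) = ε a • b
  right : ∀ a b : A,
    LinearMap.mul' ℂ A (S.lTensor A (leg₁ a * Δ b).toAlgebra) = ε b • a

end Comultiplications

end QHyper

end

open scoped TensorProduct

noncomputable section

/-! In Sweedler notation the four canonical maps are `t₁`: a ⊗ b ↦ Δ(a)(1 ⊗ b), `t₂`: a ⊗ b ↦ (a ⊗
1)Δ(b), `t₃`: a ⊗ b ↦ Δ(a)(b ⊗ 1), `t₄`: a ⊗ b ↦ (1 ⊗ a)Δ(b), all bijective on A ⊗ A by regularity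
(`CanonicalMaps`). Since Δ takes values in multipliers, each identity is proved after multiplying by
an auxiliary element, which non-degeneracy then removes.

Counit: coassociativity says that ι ⊗ t₁ and t₂ ⊗ ι commute, whence a ⊗ m(t₁⁻¹(b ⊗ c)) = m(t₂⁻¹(a ⊗
b)) ⊗ c. Both sides must be ε(b) a ⊗ c for a scalar ε(b).

Antipode: it is forced to satisfy S(p)c = (ε ⊗ ι)t₁⁻¹(p ⊗ c) (`antipode_mul`). Left invariance gives
a₁ ⊗ a₂b₁c φ(a₃b₂) = a₁φ(a₂b) ⊗ c (`t₁_slice`), so t₁⁻¹ of the right side is explicit, and applying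
ε ⊗ ι yields formula (1) (`sliceLeft_t₁_symm`). As every element is a slice a₁φ(a₂b), this also
constructs S; the mirror identity for `t₄` recovers p from S(p), so S is bijective.

Faithfulness: let N be the set of a with φ(ba) = 0 for all b. For a in N, a₁φ(a₂b) type slices
against a vanish, and (1) turns this into φ(ba₂)a₁ = 0, so the second legs of Δ(a)(e ⊗ 1) lie in N.
Hence 0 = φ(cS(a₁e)a₂) = ε(a)φ(cS(e)), so ε vanishes on N. Applying this to those legs gives ae = (ι
⊗ ε)(Δ(a)(e ⊗ 1)) = 0 for all e, so a = 0. The other side is similar, with S⁻¹. -/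

namespace QHyper

/-! ### Separating points of tensor products by slices -/

section TensorSlices

variable {V W : Type*} [AddCommGroup V] [Module ℂ V] [AddCommGroup W] [Module ℂ W]

/-- The slices `ω ⊗ ι` separate the points of a tensor product. -/
theorem eq_zero_of_rTensor_eq_zero (x : V ⊗[ℂ] W)
    (h : ∀ ω : V →ₗ[ℂ] ℂ, ω.rTensor W x = 0) : x = 0 := by
  classical
  let b := Module.Basis.ofVectorSpace ℂ V
  apply (TensorProduct.equivFinsuppOfBasisLeft (N := W) b).injective
  ext i
  rw [map_zero, TensorProduct.equivFinsuppOfBasisLeft_apply, h]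
  simp

/-- A jointly injective family stays jointly injective after tensoring on the left. -/
theorem eq_zero_of_forall_lTensor {ι W' : Type*} [AddCommGroup W'] [Module ℂ W']
    (f : ι → W →ₗ[ℂ] W') (hf : ∀ w, (∀ i, f i w = 0) → w = 0) (x : V ⊗[ℂ] W)
    (h : ∀ i, (f i).lTensor V x = 0) : x = 0 := by
  refine eq_zero_of_rTensor_eq_zero x fun ω => ?_
  apply (TensorProduct.lid ℂ W).injective
  rw [map_zero]
  refine hf _ fun i => ?_
  have : f i (TensorProduct.lid ℂ W (ω.rTensor W x)) =
      TensorProduct.lid ℂ W' (ω.rTensor W' ((f i).lTensor V x)) := by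
    clear h
    induction x with
    | zero => simp
    | add x y hx hy => simp [hx, hy]
    | tmul a b => simp
  rw [this, h, map_zero, map_zero]

/-- A jointly injective family stays jointly injective after tensoring on the right. -/
theorem eq_zero_of_forall_rTensor {ι V' : Type*} [AddCommGroup V'] [Module ℂ V']
    (f : ι → V →ₗ[ℂ] V') (hf : ∀ w, (∀ i, f i w = 0) → w = 0) (x : V ⊗[ℂ] W)
    (h : ∀ i, (f i).rTensor W x = 0) : x = 0 := by
  apply (TensorProduct.comm ℂ V W).injective
  rw [map_zero]
  refine eq_zero_of_forall_lTensor f hf _ fun i => ?_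
  have : (f i).lTensor W (TensorProduct.comm ℂ V W x) =
      TensorProduct.comm ℂ V' W ((f i).rTensor W x) := by
    clear h
    induction x with
    | zero => simp
    | add x y hx hy => simp [hx, hy]
    | tmul a b => simp
  rw [this, h, map_zero]

theorem rTensor_assoc_symm_tmul {V₁ V₂ V₃ : Type*} [AddCommGroup V₁] [Module ℂ V₁]
    [AddCommGroup V₂] [Module ℂ V₂] [AddCommGroup V₃] [Module ℂ V₃]
    (t : V₁ ⊗[ℂ] V₂ →ₗ[ℂ] W) (a : V₁) (z : V₂ ⊗[ℂ] V₃) :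
    t.rTensor V₃ ((TensorProduct.assoc ℂ V₁ V₂ V₃).symm (a ⊗ₜ z)) =
      (t ∘ₗ TensorProduct.mk ℂ V₁ V₂ a).rTensor V₃ z := by
  induction z with
  | zero => simp
  | add x y hx hy => simp only [map_add, TensorProduct.tmul_add, hx, hy]
  | tmul x y => simp

end TensorSlices

/-! ### Calculus in multiplier algebras -/

section MultiplierLemmas

variable {B : Type*} [NonUnitalRing B] [Module ℂ B] [IsScalarTower ℂ B B] [SMulCommClass ℂ B B]
variable {C : Type*} [NonUnitalRing C] [Module ℂ C] [IsScalarTower ℂ C C] [SMulCommClass ℂ C C]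

/-- Multiplications by the elements of one factor form a jointly injective family, and joint
injectivity survives tensoring; the two legs are treated one after the other. -/
theorem NondegenerateMul.tensor (hB : NondegenerateMul B) (hC : NondegenerateMul C) :
    NondegenerateMul (B ⊗[ℂ] C) where
  eq_zero_of_mul_right x h := by
    refine eq_zero_of_forall_lTensor (fun c => LinearMap.mulRight ℂ c)
      hC.eq_zero_of_mul_right x fun c => ?_
    refine eq_zero_of_forall_rTensor (fun b => LinearMap.mulRight ℂ b)
      hB.eq_zero_of_mul_right _ fun b => ?_
    rw [← h (b ⊗ₜ c)]
    clear h
    induction x with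
    | zero => simp
    | add x y hx hy => simp [hx, hy, add_mul]
    | tmul a b => simp
  eq_zero_of_mul_left x h := by
    refine eq_zero_of_forall_lTensor (fun c => LinearMap.mulLeft ℂ c)
      hC.eq_zero_of_mul_left x fun c => ?_
    refine eq_zero_of_forall_rTensor (fun b => LinearMap.mulLeft ℂ b)
      hB.eq_zero_of_mul_left _ fun b => ?_
    rw [← h (b ⊗ₜ c)]
    clear h
    induction x with
    | zero => simp
    | add x y hx hy => simp [hx, hy, mul_add]
    | tmul a b => simp

theorem NondegenerateMul.toMultiplier_injective (hB : NondegenerateMul B) :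
    Function.Injective (toMultiplier B) := by
  refine (injective_iff_map_eq_zero _).2 fun a ha => hB.eq_zero_of_mul_right a fun b => ?_
  exact congrArg (fun m : Multiplier B => m.lmul b) ha

theorem NondegenerateMul.toAlgebra_eq (hB : NondegenerateMul B) {m : Multiplier B} {b : B}
    (h : toMultiplier B b = m) : m.toAlgebra = b := by
  have hm : m.IsInAlgebra := ⟨b, h⟩
  rw [Multiplier.toAlgebra, dif_pos hm]
  exact hB.toMultiplier_injective (hm.choose_spec.trans h.symm)

@[simp] theorem Multiplier.one_lmul (x : B) : (1 : Multiplier B).lmul x = x := rfl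

@[simp] theorem Multiplier.one_rmul (x : B) : (1 : Multiplier B).rmul x = x := rfl

@[simp] theorem toMultiplier_lmul (a x : B) : (toMultiplier B a).lmul x = a * x := rfl

@[simp] theorem toMultiplier_rmul (a x : B) : (toMultiplier B a).rmul x = x * a := rfl

theorem toMultiplier_mul (a b : B) :
    toMultiplier B (a * b) = toMultiplier B a * toMultiplier B b :=
  Multiplier.ext (fun x => mul_assoc a b x) (fun x => (mul_assoc x a b).symm)

theorem Multiplier.mul_toMultiplier (m : Multiplier B) (x : B) :
    m * toMultiplier B x = toMultiplier B (m.lmul x) :=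
  Multiplier.ext (fun y => m.lmul_mul x y) (fun y => m.central y x)

theorem Multiplier.toMultiplier_mul (m : Multiplier B) (x : B) :
    toMultiplier B x * m = toMultiplier B (m.rmul x) :=
  Multiplier.ext (fun y => (m.central x y).symm) (fun y => m.rmul_mul y x)

@[simp] theorem Multiplier.tensor_lmul (m : Multiplier B) (n : Multiplier C) (x : B) (y : C) :
    (m.tensor n).lmul (x ⊗ₜ y) = m.lmul x ⊗ₜ n.lmul y := rfl

@[simp] theorem Multiplier.tensor_rmul (m : Multiplier B) (n : Multiplier C) (x : B) (y : C) :
    (m.tensor n).rmul (x ⊗ₜ y) = m.rmul x ⊗ₜ n.rmul y := rfl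

theorem Multiplier.tensor_ext {m n : Multiplier (B ⊗[ℂ] C)}
    (h : ∀ x y, m.lmul (x ⊗ₜ y) = n.lmul (x ⊗ₜ y))
    (k : ∀ x y, m.rmul (x ⊗ₜ y) = n.rmul (x ⊗ₜ y)) : m = n :=
  Multiplier.ext (LinearMap.congr_fun (TensorProduct.ext' h))
    (LinearMap.congr_fun (TensorProduct.ext' k))

theorem Multiplier.tensor_mul_tensor (m m' : Multiplier B) (n n' : Multiplier C) :
    m.tensor n * m'.tensor n' = (m * m').tensor (n * n') :=
  Multiplier.tensor_ext (fun _ _ => rfl) (fun _ _ => rfl)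

theorem toMultiplier_tensor (b : B) (c : C) :
    (toMultiplier B b).tensor (toMultiplier C c) = toMultiplier (B ⊗[ℂ] C) (b ⊗ₜ c) :=
  Multiplier.tensor_ext (fun _ _ => by simp) (fun _ _ => by simp)

theorem Multiplier.congr_mul
    (e : B ≃ₗ[ℂ] C) (he : ∀ x y, e (x * y) = e x * e y) (m n : Multiplier B) :
    Multiplier.congr e he (m * n) = Multiplier.congr e he m * Multiplier.congr e he n :=
  Multiplier.ext
    (fun x => by simp [Multiplier.congr, Multiplier.lmul, Multiplier.mk])
    (fun x => by simp [Multiplier.congr, Multiplier.rmul, Multiplier.mk])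

theorem Multiplier.congr_toMultiplier
    (e : B ≃ₗ[ℂ] C) (he : ∀ x y, e (x * y) = e x * e y) (x : B) :
    Multiplier.congr e he (toMultiplier B x) = toMultiplier C (e x) :=
  Multiplier.ext
    (fun y => by
      obtain ⟨y, rfl⟩ := e.surjective y
      simp [Multiplier.congr, Multiplier.lmul, Multiplier.mk, toMultiplier, ← he])
    (fun y => by
      obtain ⟨y, rfl⟩ := e.surjective y
      simp [Multiplier.congr, Multiplier.rmul, Multiplier.mk, toMultiplier, ← he])

end MultiplierLemmas

/-! ### Slice maps by functionals -/

section Slices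

variable {A : Type*} [NonUnitalRing A] [Module ℂ A]

@[simp] theorem sliceRight_tmul (ω : A →ₗ[ℂ] ℂ) (a b : A) : sliceRight ω (a ⊗ₜ b) = ω b • a := by
  simp [sliceRight]

@[simp] theorem sliceLeft_tmul (ω : A →ₗ[ℂ] ℂ) (a b : A) : sliceLeft ω (a ⊗ₜ b) = ω a • b := by
  simp [sliceLeft]

theorem lTensor_sliceRight_assoc_tmul (ω : A →ₗ[ℂ] ℂ) (x : A ⊗[ℂ] A) (c : A) :
    (sliceRight ω).lTensor A (TensorProduct.assoc ℂ A A A (x ⊗ₜ c)) = ω c • x := by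
  induction x with
  | zero => simp
  | add x y hx hy => rw [TensorProduct.add_tmul, map_add, map_add, smul_add, hx, hy]
  | tmul a b => simp

theorem lTensor_sliceLeft_assoc_tmul (ω : A →ₗ[ℂ] ℂ) (x : A ⊗[ℂ] A) (c : A) :
    (sliceLeft ω).lTensor A (TensorProduct.assoc ℂ A A A (x ⊗ₜ c)) = sliceRight ω x ⊗ₜ c := by
  induction x with
  | zero => simp
  | add x y hx hy =>
    rw [TensorProduct.add_tmul, map_add, map_add, map_add, hx, hy, TensorProduct.add_tmul]
  | tmul a b => simp [TensorProduct.smul_tmul']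

/-- Fubini: both sides are (ω ⊗ φ)(x). -/
theorem apply_sliceLeft (φ ω : A →ₗ[ℂ] ℂ) (x : A ⊗[ℂ] A) :
    φ (sliceLeft ω x) = ω (sliceRight φ x) := by
  induction x with
  | zero => simp
  | add x y hx hy => simp [hx, hy]
  | tmul a b => simp [mul_comm]

/-- If the left slices of `x` lie in the kernel of `β`, then `β` contracts `x` to zero. -/
theorem lift_eq_zero_of_sliceLeft (β : A →ₗ[ℂ] A →ₗ[ℂ] ℂ) (x : A ⊗[ℂ] A)
    (hx : ∀ ω : A →ₗ[ℂ] ℂ, β (sliceLeft ω x) = 0) (f : A →ₗ[ℂ] A) :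
    TensorProduct.lift (β.flip ∘ₗ f) x = 0 := by
  have h : β.lTensor A x = 0 := by
    refine eq_zero_of_rTensor_eq_zero _ fun ω => ?_
    apply (TensorProduct.lid ℂ _).injective
    rw [map_zero, ← hx ω]
    clear hx
    induction x with
    | zero => simp
    | add x y hx hy => simp only [map_add, hx, hy]
    | tmul a b => simp
  -- The contraction evaluates the functional in the second leg of (ι ⊗ β)(x) at `f` of the first
  -- leg, so it factors through `β.lTensor A`.
  have h2 : TensorProduct.lift (β.flip ∘ₗ f) x =
      TensorProduct.lift ((LinearMap.id : (A →ₗ[ℂ] ℂ) →ₗ[ℂ] _).flip ∘ₗ f) (β.lTensor A x) := by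
    clear h hx
    induction x with
    | zero => simp
    | add x y hx hy => simp only [map_add, hx, hy]
    | tmul a b => simp
  rw [h2, h, map_zero]

theorem sliceRight_eq_zero_of_sliceLeft (ε : A →ₗ[ℂ] ℂ) (x : A ⊗[ℂ] A)
    (hx : ∀ ω : A →ₗ[ℂ] ℂ, ε (sliceLeft ω x) = 0) : sliceRight ε x = 0 := by
  refine (Module.forall_dual_apply_eq_zero_iff ℂ _).1 fun ω => ?_
  rw [← apply_sliceLeft, hx]

end Slices

/-! ### Multiplication in a single leg, and the flip -/

section Legs

variable {A : Type*} [NonUnitalRing A] [Module ℂ A] [IsScalarTower ℂ A A] [SMulCommClass ℂ A A]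

theorem leg₁_mul_leg₂ (a b : A) : leg₁ a * leg₂ b = toMultiplier (A ⊗[ℂ] A) (a ⊗ₜ b) := by
  simp [leg₁, leg₂, Multiplier.tensor_mul_tensor, toMultiplier_tensor]

theorem leg₂_mul_leg₁ (a b : A) : leg₂ b * leg₁ a = toMultiplier (A ⊗[ℂ] A) (a ⊗ₜ b) := by
  simp [leg₁, leg₂, Multiplier.tensor_mul_tensor, toMultiplier_tensor]

@[simp] theorem leg₁_lmul (a x y : A) : (leg₁ a).lmul (x ⊗ₜ y) = (a * x) ⊗ₜ y := rfl
@[simp] theorem leg₂_lmul (a x y : A) : (leg₂ a).lmul (x ⊗ₜ y) = x ⊗ₜ (a * y) := rfl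
@[simp] theorem leg₁_rmul (a x y : A) : (leg₁ a).rmul (x ⊗ₜ y) = (x * a) ⊗ₜ y := rfl
@[simp] theorem leg₂_rmul (a x y : A) : (leg₂ a).rmul (x ⊗ₜ y) = x ⊗ₜ (y * a) := rfl

@[simp] theorem flip_leg₁ (a : A) : flip (leg₁ a) = leg₂ a :=
  Multiplier.tensor_ext (fun _ _ => rfl) (fun _ _ => rfl)

@[simp] theorem flip_leg₂ (a : A) : flip (leg₂ a) = leg₁ a :=
  Multiplier.tensor_ext (fun _ _ => rfl) (fun _ _ => rfl)

theorem flip_mul (m n : Multiplier (A ⊗[ℂ] A)) : flip (m * n) = flip m * flip n :=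
  Multiplier.congr_mul _ _ m n

theorem flip_flip (m : Multiplier (A ⊗[ℂ] A)) : flip (flip m) = m :=
  Multiplier.tensor_ext
    (fun x y => by simp [flip, Multiplier.congr, Multiplier.lmul, Multiplier.mk])
    (fun x y => by simp [flip, Multiplier.congr, Multiplier.rmul, Multiplier.mk])

theorem flip_toMultiplier (x : A ⊗[ℂ] A) :
    flip (toMultiplier (A ⊗[ℂ] A) x) = toMultiplier (A ⊗[ℂ] A) (TensorProduct.comm ℂ A A x) :=
  Multiplier.congr_toMultiplier _ _ x

theorem sliceRight_leg₁_lmul (ω : A →ₗ[ℂ] ℂ) (a : A) (x : A ⊗[ℂ] A) :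
    sliceRight ω ((leg₁ a).lmul x) = a * sliceRight ω x := by
  induction x with
  | zero => simp
  | add x y hx hy => simp [hx, hy, mul_add]
  | tmul x y => simp [mul_smul_comm]

theorem sliceRight_leg₁_rmul (ω : A →ₗ[ℂ] ℂ) (a : A) (x : A ⊗[ℂ] A) :
    sliceRight ω ((leg₁ a).rmul x) = sliceRight ω x * a := by
  induction x with
  | zero => simp
  | add x y hx hy => simp [hx, hy, add_mul]
  | tmul x y => simp [smul_mul_assoc]

theorem sliceLeft_leg₂_lmul (ω : A →ₗ[ℂ] ℂ) (a : A) (x : A ⊗[ℂ] A) :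
    sliceLeft ω ((leg₂ a).lmul x) = a * sliceLeft ω x := by
  induction x with
  | zero => simp
  | add x y hx hy => simp [hx, hy, mul_add]
  | tmul x y => simp [mul_smul_comm]

theorem sliceLeft_leg₂_rmul (ω : A →ₗ[ℂ] ℂ) (a : A) (x : A ⊗[ℂ] A) :
    sliceLeft ω ((leg₂ a).rmul x) = sliceLeft ω x * a := by
  induction x with
  | zero => simp
  | add x y hx hy => simp [hx, hy, add_mul]
  | tmul x y => simp [smul_mul_assoc]

theorem eq_zero_of_leg₁_lmul (hA : NondegenerateMul A) (x : A ⊗[ℂ] A)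
    (h : ∀ a, (leg₁ a).lmul x = 0) : x = 0 := by
  refine eq_zero_of_forall_rTensor (fun a => LinearMap.mulLeft ℂ a) hA.eq_zero_of_mul_left x
    fun a => ?_
  rw [← h a]
  clear h
  induction x with
  | zero => simp
  | add x y hx hy => simp [hx, hy]
  | tmul x y => simp

theorem eq_zero_of_leg₁_rmul (hA : NondegenerateMul A) (x : A ⊗[ℂ] A)
    (h : ∀ a, (leg₁ a).rmul x = 0) : x = 0 := by
  refine eq_zero_of_forall_rTensor (fun a => LinearMap.mulRight ℂ a) hA.eq_zero_of_mul_right x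
    fun a => ?_
  rw [← h a]
  clear h
  induction x with
  | zero => simp
  | add x y hx hy => simp [hx, hy]
  | tmul x y => simp

end Legs

/-! ### The four canonical maps and coassociativity inside A ⊗ A ⊗ A -/

section CanonicalMaps

variable {A : Type*} [NonUnitalRing A] [Module ℂ A] [IsScalarTower ℂ A A] [SMulCommClass ℂ A A]

theorem reassoc_mul (m n : Multiplier ((A ⊗[ℂ] A) ⊗[ℂ] A)) :
    reassoc (m * n) = reassoc m * reassoc n :=
  Multiplier.congr_mul _ _ m n

theorem reassoc_toMultiplier (x : (A ⊗[ℂ] A) ⊗[ℂ] A) :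
    reassoc (toMultiplier _ x) = toMultiplier _ (TensorProduct.assoc ℂ A A A x) :=
  Multiplier.congr_toMultiplier _ _ x

theorem reassoc_leg₁_tensor_one (a : A) :
    reassoc ((leg₁ a).tensor (1 : Multiplier A)) =
      (toMultiplier A a).tensor (1 : Multiplier (A ⊗[ℂ] A)) := by
  apply Multiplier.ext
  · refine LinearMap.congr_fun (TensorProduct.ext' fun x y => ?_)
    induction y with
    | zero => simp
    | add y z hy hz => rw [TensorProduct.tmul_add, map_add, map_add, hy, hz]
    | tmul y z => rfl
  · refine LinearMap.congr_fun (TensorProduct.ext' fun x y => ?_)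
    induction y with
    | zero => simp
    | add y z hy hz => rw [TensorProduct.tmul_add, map_add, map_add, hy, hz]
    | tmul y z => rfl

/-- Together with `idTensorComul_mul_leg₂`, this shows that both sides of the coassociativity axiom
lie in the threefold tensor product, so that the axiom becomes an identity between canonical maps.
-/
theorem leg₁_mul_reassoc_comulTensorId {Δ : A →ₗ[ℂ] Multiplier (A ⊗[ℂ] A)}
    {t : A ⊗[ℂ] A →ₗ[ℂ] A ⊗[ℂ] A}
    (ht : ∀ a b, toMultiplier (A ⊗[ℂ] A) (t (a ⊗ₜ b)) = leg₁ a * Δ b)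
    (a : A) (x : A ⊗[ℂ] A) :
    (toMultiplier A a).tensor (1 : Multiplier (A ⊗[ℂ] A)) * reassoc (comulTensorId Δ x) =
      toMultiplier _ (TensorProduct.assoc ℂ A A A
        ((t ∘ₗ TensorProduct.mk ℂ A A a).rTensor A x)) := by
  induction x with
  | zero => simp
  | add x y hx hy => rw [map_add, map_add, mul_add, hx, hy, map_add, map_add, map_add]
  | tmul b c =>
    have : comulTensorId Δ (b ⊗ₜ c) = (Δ b).tensor (toMultiplier A c) := rfl
    rw [this, ← reassoc_leg₁_tensor_one, ← reassoc_mul, Multiplier.tensor_mul_tensor, ← ht,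
      one_mul, toMultiplier_tensor, reassoc_toMultiplier]
    rfl

theorem idTensorComul_mul_leg₂ {Δ : A →ₗ[ℂ] Multiplier (A ⊗[ℂ] A)}
    {t : A ⊗[ℂ] A →ₗ[ℂ] A ⊗[ℂ] A}
    (ht : ∀ a b, toMultiplier (A ⊗[ℂ] A) (t (a ⊗ₜ b)) = Δ a * leg₂ b)
    (c : A) (x : A ⊗[ℂ] A) :
    idTensorComul Δ x * (1 : Multiplier A).tensor (leg₂ c) =
      toMultiplier _ ((t ∘ₗ (TensorProduct.mk ℂ A A).flip c).lTensor A x) := by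
  induction x with
  | zero => simp
  | add x y hx hy => rw [map_add, add_mul, hx, hy, map_add, map_add]
  | tmul a b =>
    have : idTensorComul Δ (a ⊗ₜ b) = (toMultiplier A a).tensor (Δ b) := rfl
    rw [this, Multiplier.tensor_mul_tensor, ← ht, mul_one, toMultiplier_tensor]
    rfl

/-- The linear bijection of `B` induced by a linear map to `M(B)` which is a bijection onto `B`. -/
theorem exists_linearEquiv_of_bijOn {V B : Type*} [AddCommGroup V] [Module ℂ V]
    [NonUnitalRing B] [Module ℂ B] [IsScalarTower ℂ B B] [SMulCommClass ℂ B B]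
    (hB : NondegenerateMul B) (g : V →ₗ[ℂ] Multiplier B)
    (hg : Set.BijOn g Set.univ (Set.range (toMultiplier B))) :
    ∃ t : V ≃ₗ[ℂ] B, ∀ x, toMultiplier B (t x) = g x := by
  let e := LinearEquiv.ofInjective (toMultiplier B) hB.toMultiplier_injective
  let f : V →ₗ[ℂ] LinearMap.range (toMultiplier B) :=
    g.codRestrict _ fun x => hg.mapsTo (Set.mem_univ x)
  have hf : Function.Bijective f := by
    constructor
    · intro x y hxy
      exact hg.injOn (Set.mem_univ x) (Set.mem_univ y) (congrArg Subtype.val hxy)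
    · rintro ⟨y, hy⟩
      obtain ⟨x, -, hx⟩ := hg.surjOn hy
      exact ⟨x, Subtype.ext hx⟩
  refine ⟨(LinearEquiv.ofBijective f hf).trans e.symm, fun x => ?_⟩
  exact congrArg Subtype.val (e.apply_symm_apply (f x))

/-- For a multiplier Hopf algebra, the canonical maps as bijections of `A ⊗ A`, together with
coassociativity expressed in terms of these maps. -/
theorem IsMultiplierHopfAlgebra.exists_canonical {Δ : A →ₗ[ℂ] Multiplier (A ⊗[ℂ] A)}
    (h : IsMultiplierHopfAlgebra Δ) :
    ∃ t₁ t₂ : A ⊗[ℂ] A ≃ₗ[ℂ] A ⊗[ℂ] A,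
      (∀ a b, toMultiplier (A ⊗[ℂ] A) (t₁ (a ⊗ₜ b)) = Δ a * leg₂ b) ∧
      (∀ a b, toMultiplier (A ⊗[ℂ] A) (t₂ (a ⊗ₜ b)) = leg₁ a * Δ b) ∧
      ∀ a b c, TensorProduct.assoc ℂ A A A
          ((t₂.toLinearMap ∘ₗ TensorProduct.mk ℂ A A a).rTensor A (t₁ (b ⊗ₜ c))) =
        (t₁.toLinearMap ∘ₗ (TensorProduct.mk ℂ A A).flip c).lTensor A (t₂ (a ⊗ₜ b)) := by
  have h2 := h.nondegenerate.tensor h.nondegenerate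
  have h3 := h.nondegenerate.tensor h2
  obtain ⟨t₁, ht₁⟩ := exists_linearEquiv_of_bijOn h2 _ h.bijOn_galois₁
  obtain ⟨t₂, ht₂⟩ := exists_linearEquiv_of_bijOn h2 _ h.bijOn_galois₂
  have k₁ : ∀ a b, toMultiplier (A ⊗[ℂ] A) (t₁ (a ⊗ₜ b)) = Δ a * leg₂ b := fun a b => ht₁ _
  have k₂ : ∀ a b, toMultiplier (A ⊗[ℂ] A) (t₂ (a ⊗ₜ b)) = leg₁ a * Δ b := fun a b => ht₂ _
  refine ⟨t₁, t₂, k₁, k₂, fun a b c => h3.toMultiplier_injective ?_⟩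
  have := h.comul.coassoc a b c
  rwa [h2.toAlgebra_eq (k₁ b c), h2.toAlgebra_eq (k₂ a b),
    leg₁_mul_reassoc_comulTensorId (t := t₂.toLinearMap) k₂,
    idTensorComul_mul_leg₂ (t := t₁.toLinearMap) k₁] at this

/-- The bijections `a ⊗ b ↦ Δ(a)(1 ⊗ b)`, `a ⊗ b ↦ (a ⊗ 1)Δ(b)`, `a ⊗ b ↦ Δ(a)(b ⊗ 1)` and
`a ⊗ b ↦ (1 ⊗ a)Δ(b)` of `A ⊗ A` attached to a regular multiplier Hopf algebra, together with
coassociativity expressed in terms of these maps. -/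
structure CanonicalMaps (Δ : A →ₗ[ℂ] Multiplier (A ⊗[ℂ] A)) where
  nondegenerate : NondegenerateMul A
  map_mul : ∀ a b : A, Δ (a * b) = Δ a * Δ b
  t₁ : A ⊗[ℂ] A ≃ₗ[ℂ] A ⊗[ℂ] A
  t₂ : A ⊗[ℂ] A ≃ₗ[ℂ] A ⊗[ℂ] A
  t₃ : A ⊗[ℂ] A ≃ₗ[ℂ] A ⊗[ℂ] A
  t₄ : A ⊗[ℂ] A ≃ₗ[ℂ] A ⊗[ℂ] A
  t₁_spec : ∀ a b, toMultiplier (A ⊗[ℂ] A) (t₁ (a ⊗ₜ b)) = Δ a * leg₂ b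
  t₂_spec : ∀ a b, toMultiplier (A ⊗[ℂ] A) (t₂ (a ⊗ₜ b)) = leg₁ a * Δ b
  t₃_spec : ∀ a b, toMultiplier (A ⊗[ℂ] A) (t₃ (a ⊗ₜ b)) = Δ a * leg₁ b
  t₄_spec : ∀ a b, toMultiplier (A ⊗[ℂ] A) (t₄ (a ⊗ₜ b)) = leg₂ a * Δ b
  coassoc₁₂ : ∀ a b c, TensorProduct.assoc ℂ A A A
      ((t₂.toLinearMap ∘ₗ TensorProduct.mk ℂ A A a).rTensor A (t₁ (b ⊗ₜ c))) =
    (t₁.toLinearMap ∘ₗ (TensorProduct.mk ℂ A A).flip c).lTensor A (t₂ (a ⊗ₜ b))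
  coassoc₃₄ : ∀ a b c,
    (t₄.toLinearMap ∘ₗ TensorProduct.mk ℂ A A a).lTensor A (t₃ (b ⊗ₜ c)) =
      TensorProduct.assoc ℂ A A A
        ((t₃.toLinearMap ∘ₗ (TensorProduct.mk ℂ A A).flip c).rTensor A (t₄ (a ⊗ₜ b)))

/-- The reversal `a ⊗ (b ⊗ c) ↦ c ⊗ (b ⊗ a)`. -/
def reverse₃ (V : Type*) [AddCommGroup V] [Module ℂ V] :
    V ⊗[ℂ] (V ⊗[ℂ] V) ≃ₗ[ℂ] V ⊗[ℂ] (V ⊗[ℂ] V) :=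
  ((TensorProduct.comm ℂ V V).lTensor V).trans
    ((TensorProduct.comm ℂ V (V ⊗[ℂ] V)).trans (TensorProduct.assoc ℂ V V V))

@[simp] theorem reverse₃_tmul {V : Type*} [AddCommGroup V] [Module ℂ V] (a b c : V) :
    reverse₃ V (a ⊗ₜ (b ⊗ₜ c)) = c ⊗ₜ (b ⊗ₜ a) := rfl

theorem assoc_rTensor_comm {V : Type*} [AddCommGroup V] [Module ℂ V]
    (f : V →ₗ[ℂ] V ⊗[ℂ] V) (x : V ⊗[ℂ] V) :
    TensorProduct.assoc ℂ V V V (((TensorProduct.comm ℂ V V).toLinearMap ∘ₗ f).rTensor V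
      (TensorProduct.comm ℂ V V x)) = reverse₃ V (f.lTensor V x) := by
  induction x with
  | zero => simp
  | add x y hx hy => simp only [map_add, hx, hy]
  | tmul m n =>
    simp only [TensorProduct.comm_tmul, LinearMap.rTensor_tmul, LinearMap.lTensor_tmul,
      LinearMap.comp_apply, LinearEquiv.coe_coe]
    induction f n with
    | zero => simp
    | add x y hx hy => simp only [map_add, TensorProduct.add_tmul, TensorProduct.tmul_add, hx, hy]
    | tmul p q => simp

theorem lTensor_comm {V : Type*} [AddCommGroup V] [Module ℂ V]
    (f : V →ₗ[ℂ] V ⊗[ℂ] V) (x : V ⊗[ℂ] V) :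
    ((TensorProduct.comm ℂ V V).toLinearMap ∘ₗ f).lTensor V (TensorProduct.comm ℂ V V x) =
      reverse₃ V (TensorProduct.assoc ℂ V V V (f.rTensor V x)) := by
  induction x with
  | zero => simp
  | add x y hx hy => simp only [map_add, hx, hy]
  | tmul m n =>
    simp only [TensorProduct.comm_tmul, LinearMap.rTensor_tmul, LinearMap.lTensor_tmul,
      LinearMap.comp_apply, LinearEquiv.coe_coe]
    induction f m with
    | zero => simp
    | add x y hx hy => simp only [map_add, TensorProduct.add_tmul, TensorProduct.tmul_add, hx, hy]
    | tmul p q => simp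

theorem IsRegularMultiplierHopfAlgebra.nonempty_canonicalMaps
    {Δ : A →ₗ[ℂ] Multiplier (A ⊗[ℂ] A)} (h : IsRegularMultiplierHopfAlgebra Δ) :
    Nonempty (CanonicalMaps Δ) := by
  obtain ⟨t₁, t₂, k₁, k₂, hc⟩ := h.hopf.exists_canonical
  obtain ⟨s₁, s₂, l₁, l₂, hd⟩ := h.hopf_op.exists_canonical
  refine ⟨{
    nondegenerate := h.hopf.nondegenerate
    map_mul := h.hopf.map_mul
    t₁ := t₁
    t₂ := t₂
    t₃ := s₁.trans (TensorProduct.comm ℂ A A)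
    t₄ := s₂.trans (TensorProduct.comm ℂ A A)
    t₁_spec := k₁
    t₂_spec := k₂
    t₃_spec := fun a b => ?_
    t₄_spec := fun a b => ?_
    coassoc₁₂ := hc
    coassoc₃₄ := fun a b c => ?_ }⟩
  · rw [LinearEquiv.trans_apply, ← flip_toMultiplier, l₁, flip_mul, flip_leg₂]
    exact congrArg (· * leg₁ b) (flip_flip (Δ a))
  · rw [LinearEquiv.trans_apply, ← flip_toMultiplier, l₂, flip_mul, flip_leg₁]
    exact congrArg (leg₂ a * ·) (flip_flip (Δ b))
  -- Reversing the three legs turns coassociativity of the flipped comultiplication into the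
  -- required identity.
  · apply (reverse₃ A).injective
    rw [← assoc_rTensor_comm, ← lTensor_comm]
    have e : ∀ (s : A ⊗[ℂ] A ≃ₗ[ℂ] A ⊗[ℂ] A) (f : A →ₗ[ℂ] A ⊗[ℂ] A),
        (TensorProduct.comm ℂ A A).toLinearMap ∘ₗ
          ((s.trans (TensorProduct.comm ℂ A A)).toLinearMap ∘ₗ f) = s.toLinearMap ∘ₗ f := by
      intro s f
      ext x
      simp
    rw [e, e]
    simpa using hd a b c

end CanonicalMaps

/-! ### Relations between the canonical maps -/

section CanonicalIdentities

variable {A : Type*} [NonUnitalRing A] [Module ℂ A] [IsScalarTower ℂ A A] [SMulCommClass ℂ A A]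

theorem lTensor_mul'_assoc_tmul (x : A ⊗[ℂ] A) (c : A) :
    (LinearMap.mul' ℂ A).lTensor A (TensorProduct.assoc ℂ A A A (x ⊗ₜ c)) = (leg₂ c).rmul x := by
  induction x with
  | zero => simp
  | add x y hx hy => rw [TensorProduct.add_tmul, map_add, map_add, map_add, hx, hy]
  | tmul a b => simp

theorem leg₂_rmul_lTensor (c : A) (f : A →ₗ[ℂ] A) (x : A ⊗[ℂ] A) :
    (leg₂ c).rmul (f.lTensor A x) = (LinearMap.mulRight ℂ c ∘ₗ f).lTensor A x := by
  induction x with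
  | zero => simp
  | add x y hx hy => simp [hx, hy]
  | tmul a b => simp

theorem leg₂_lmul_lTensor (c : A) (f : A →ₗ[ℂ] A) (x : A ⊗[ℂ] A) :
    (leg₂ c).lmul (f.lTensor A x) = (LinearMap.mulLeft ℂ c ∘ₗ f).lTensor A x := by
  induction x with
  | zero => simp
  | add x y hx hy => simp [hx, hy]
  | tmul a b => simp

variable {Δ : A →ₗ[ℂ] Multiplier (A ⊗[ℂ] A)}

variable (Δ) in
/-- The bilinear map `(x, w) ↦ (ι ⊗ φ)(Δ(w)x)`. -/
def sliceComulMul (φ : A →ₗ[ℂ] ℂ) : A ⊗[ℂ] A →ₗ[ℂ] A →ₗ[ℂ] A :=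
  LinearMap.mk₂ ℂ (fun x w => sliceRight φ ((Δ w).lmul x))
    (fun x y w => by simp) (fun r x w => by simp)
    (fun x w w' => by rw [map_add Δ, ← map_add (sliceRight φ)]; rfl)
    (fun r x w => by rw [map_smul Δ, ← map_smul (sliceRight φ)]; rfl)

variable (Δ) in
/-- The bilinear map `(x, w) ↦ (ι ⊗ φ)(xΔ(w))`. -/
def sliceMulComul (φ : A →ₗ[ℂ] ℂ) : A ⊗[ℂ] A →ₗ[ℂ] A →ₗ[ℂ] A :=
  LinearMap.mk₂ ℂ (fun x w => sliceRight φ ((Δ w).rmul x))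
    (fun x y w => by simp) (fun r x w => by simp)
    (fun x w w' => by rw [map_add Δ, ← map_add (sliceRight φ)]; rfl)
    (fun r x w => by rw [map_smul Δ, ← map_smul (sliceRight φ)]; rfl)

namespace CanonicalMaps

theorem toMultiplier_injective (T : CanonicalMaps Δ) :
    Function.Injective (toMultiplier (A ⊗[ℂ] A)) :=
  (T.nondegenerate.tensor T.nondegenerate).toMultiplier_injective

variable (T : CanonicalMaps Δ)

theorem toAlgebra_t₁ (a b : A) : (Δ a * leg₂ b).toAlgebra = T.t₁ (a ⊗ₜ b) :=
  (T.nondegenerate.tensor T.nondegenerate).toAlgebra_eq (T.t₁_spec a b)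

theorem toAlgebra_t₂ (a b : A) : (leg₁ a * Δ b).toAlgebra = T.t₂ (a ⊗ₜ b) :=
  (T.nondegenerate.tensor T.nondegenerate).toAlgebra_eq (T.t₂_spec a b)

theorem toAlgebra_t₃ (a b : A) : (Δ a * leg₁ b).toAlgebra = T.t₃ (a ⊗ₜ b) :=
  (T.nondegenerate.tensor T.nondegenerate).toAlgebra_eq (T.t₃_spec a b)

theorem toAlgebra_t₄ (a b : A) : (leg₂ a * Δ b).toAlgebra = T.t₄ (a ⊗ₜ b) :=
  (T.nondegenerate.tensor T.nondegenerate).toAlgebra_eq (T.t₄_spec a b)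

/-- The product (c ⊗ 1)Δ(a)(1 ⊗ b) bracketed in two ways. This relation and its variants below
transfer information from one canonical map to another. -/
theorem leg₁_lmul_t₁ (a b c : A) :
    (leg₁ c).lmul (T.t₁ (a ⊗ₜ b)) = (leg₂ b).rmul (T.t₂ (c ⊗ₜ a)) := by
  apply T.toMultiplier_injective
  rw [← Multiplier.mul_toMultiplier, ← Multiplier.toMultiplier_mul, t₁_spec, t₂_spec, mul_assoc]

theorem leg₁_rmul_t₁ (a b c : A) :
    (leg₁ c).rmul (T.t₁ (a ⊗ₜ b)) = (leg₂ b).rmul (T.t₃ (a ⊗ₜ c)) := by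
  apply T.toMultiplier_injective
  rw [← Multiplier.toMultiplier_mul, ← Multiplier.toMultiplier_mul, t₁_spec, t₃_spec, mul_assoc,
    mul_assoc, leg₁_mul_leg₂, leg₂_mul_leg₁]

theorem leg₂_lmul_t₃ (a b c : A) :
    (leg₂ a).lmul (T.t₃ (b ⊗ₜ c)) = (leg₁ c).rmul (T.t₄ (a ⊗ₜ b)) := by
  apply T.toMultiplier_injective
  rw [← Multiplier.mul_toMultiplier, ← Multiplier.toMultiplier_mul, t₃_spec, t₄_spec, mul_assoc]

theorem leg₂_lmul_t₁ (a b c : A) :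
    (leg₂ a).lmul (T.t₁ (b ⊗ₜ c)) = (leg₂ c).rmul (T.t₄ (a ⊗ₜ b)) := by
  apply T.toMultiplier_injective
  rw [← Multiplier.mul_toMultiplier, ← Multiplier.toMultiplier_mul, t₁_spec, t₄_spec, mul_assoc]

theorem leg₁_lmul_t₃ (a b c : A) :
    (leg₁ a).lmul (T.t₃ (b ⊗ₜ c)) = (leg₁ c).rmul (T.t₂ (a ⊗ₜ b)) := by
  apply T.toMultiplier_injective
  rw [← Multiplier.mul_toMultiplier, ← Multiplier.toMultiplier_mul, t₃_spec, t₂_spec, mul_assoc]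

theorem comul_lmul_t₁ (a b c : A) : (Δ a).lmul (T.t₁ (b ⊗ₜ c)) = T.t₁ ((a * b) ⊗ₜ c) := by
  apply T.toMultiplier_injective
  rw [← Multiplier.mul_toMultiplier, t₁_spec, t₁_spec, T.map_mul, mul_assoc]

theorem comul_lmul_t₃ (a b c : A) : (Δ a).lmul (T.t₃ (b ⊗ₜ c)) = T.t₃ ((a * b) ⊗ₜ c) := by
  apply T.toMultiplier_injective
  rw [← Multiplier.mul_toMultiplier, t₃_spec, t₃_spec, T.map_mul, mul_assoc]

theorem comul_rmul_t₂ (a b c : A) : (Δ a).rmul (T.t₂ (c ⊗ₜ b)) = T.t₂ (c ⊗ₜ (b * a)) := by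
  apply T.toMultiplier_injective
  rw [← Multiplier.toMultiplier_mul, t₂_spec, t₂_spec, T.map_mul, mul_assoc]

theorem comul_lmul_tmul (a b c : A) :
    (Δ a).lmul (b ⊗ₜ c) = (leg₁ b).rmul (T.t₁ (a ⊗ₜ c)) := by
  apply T.toMultiplier_injective
  rw [← Multiplier.mul_toMultiplier, ← Multiplier.toMultiplier_mul, t₁_spec, mul_assoc,
    leg₂_mul_leg₁]

theorem comul_rmul_tmul (a b c : A) :
    (Δ a).rmul (b ⊗ₜ c) = (leg₁ b).lmul (T.t₄ (c ⊗ₜ a)) := by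
  apply T.toMultiplier_injective
  rw [← Multiplier.toMultiplier_mul, ← Multiplier.mul_toMultiplier, t₄_spec, ← mul_assoc,
    leg₁_mul_leg₂]

/-! ### Commutation of canonical maps and the counit -/

theorem lTensor_mul'_t₂ (a : A) (y : A ⊗[ℂ] A) :
    (LinearMap.mul' ℂ A).lTensor A (TensorProduct.assoc ℂ A A A
      ((T.t₂.toLinearMap ∘ₗ TensorProduct.mk ℂ A A a).rTensor A y)) = (leg₁ a).lmul (T.t₁ y) := by
  induction y with
  | zero => simp
  | add x y hx hy => simp only [map_add, hx, hy]
  | tmul b c =>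
    rw [leg₁_lmul_t₁, ← lTensor_mul'_assoc_tmul]
    rfl

/-- The maps `ι ⊗ t₁` and `t₂ ⊗ ι` commute. -/
theorem lTensor_t₁_rTensor_t₂ (u : (A ⊗[ℂ] A) ⊗[ℂ] A) :
    T.t₁.toLinearMap.lTensor A (TensorProduct.assoc ℂ A A A (T.t₂.toLinearMap.rTensor A u)) =
      TensorProduct.assoc ℂ A A A (T.t₂.toLinearMap.rTensor A ((TensorProduct.assoc ℂ A A A).symm
        (T.t₁.toLinearMap.lTensor A (TensorProduct.assoc ℂ A A A u)))) := by
  induction u with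
  | zero => simp
  | add x y hx hy => simp only [map_add, hx, hy]
  | tmul x c =>
    induction x with
    | zero => simp
    | add x y hx hy => simp only [map_add, TensorProduct.add_tmul, hx, hy]
    | tmul a b =>
      have h := T.coassoc₁₂ a b c
      have h1 : ∀ z : A ⊗[ℂ] A, T.t₁.toLinearMap.lTensor A (TensorProduct.assoc ℂ A A A (z ⊗ₜ c)) =
          (T.t₁.toLinearMap ∘ₗ (TensorProduct.mk ℂ A A).flip c).lTensor A z := by
        intro z
        induction z with
        | zero => simp
        | add x y hx hy => simp only [map_add, TensorProduct.add_tmul, hx, hy]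
        | tmul x y => simp
      rw [TensorProduct.assoc_tmul, LinearMap.lTensor_tmul, LinearEquiv.coe_coe,
        rTensor_assoc_symm_tmul, h,
        LinearMap.rTensor_tmul, h1]
      rfl

theorem lTensor_t₁_assoc (a : A) (y : A ⊗[ℂ] A) :
    T.t₁.toLinearMap.lTensor A (TensorProduct.assoc ℂ A A A
        ((T.t₂.toLinearMap ∘ₗ TensorProduct.mk ℂ A A a).rTensor A y)) =
      TensorProduct.assoc ℂ A A A
        ((T.t₂.toLinearMap ∘ₗ TensorProduct.mk ℂ A A a).rTensor A (T.t₁ y)) := by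
  induction y with
  | zero => simp
  | add x y hx hy => simp only [map_add, hx, hy]
  | tmul b c =>
    have := T.lTensor_t₁_rTensor_t₂ ((a ⊗ₜ b) ⊗ₜ c)
    rwa [TensorProduct.assoc_tmul, LinearMap.lTensor_tmul, LinearEquiv.coe_coe,
      rTensor_assoc_symm_tmul] at this

/-- Writing x = t₂(a ⊗ b) and y = t₁⁻¹(b ⊗ c), commutation gives x ⊗ c = (ι ⊗ t₁)(t₂ ⊗ ι)(a ⊗ y).
Then ι ⊗ m t₁⁻¹ sends it to (ι ⊗ m)(t₂ ⊗ ι)(a ⊗ y) = (a ⊗ 1)t₁(y) = ab ⊗ c. -/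
theorem lTensor_mul'_t₁_symm (x : A ⊗[ℂ] A) (c : A) :
    (LinearMap.mul' ℂ A ∘ₗ T.t₁.symm.toLinearMap).lTensor A
      (TensorProduct.assoc ℂ A A A (x ⊗ₜ c)) = LinearMap.mul' ℂ A (T.t₂.symm x) ⊗ₜ c := by
  obtain ⟨x, rfl⟩ := T.t₂.surjective x
  induction x with
  | zero => simp
  | add x y hx hy =>
    simp only [map_add, TensorProduct.add_tmul, hx, hy, LinearEquiv.symm_apply_apply] at *
  | tmul a b =>
    have h := T.lTensor_t₁_assoc a (T.t₁.symm (b ⊗ₜ c))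
    rw [LinearEquiv.apply_symm_apply] at h
    have h' : T.t₂ (a ⊗ₜ b) ⊗ₜ[ℂ] c =
      (T.t₂.toLinearMap ∘ₗ TensorProduct.mk ℂ A A a).rTensor A (b ⊗ₜ c) := rfl
    have h1 : (LinearMap.mul' ℂ A ∘ₗ T.t₁.symm.toLinearMap) ∘ₗ T.t₁.toLinearMap =
        LinearMap.mul' ℂ A := by ext; simp
    rw [h', ← h, ← LinearMap.lTensor_comp_apply, h1, lTensor_mul'_t₂, LinearEquiv.apply_symm_apply,
      LinearEquiv.symm_apply_apply]
    simp

/-- The counit, characterised by `m = (ε ⊗ ι) t₁ = (ι ⊗ ε) t₂`. -/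
theorem exists_counit {φ : A →ₗ[ℂ] ℂ} {v : A} (hv : φ v = 1) :
    ∃ ε : A →ₗ[ℂ] ℂ, (∀ x, sliceLeft ε (T.t₁ x) = LinearMap.mul' ℂ A x) ∧
      ∀ x, sliceRight ε (T.t₂ x) = LinearMap.mul' ℂ A x := by
  -- Invariance plays no role here: φ only has to be a functional with φ(v) = 1, used to strip off a
  -- tensor factor.
  let ε : A →ₗ[ℂ] ℂ :=
    φ ∘ₗ LinearMap.mul' ℂ A ∘ₗ T.t₂.symm.toLinearMap ∘ₗ TensorProduct.mk ℂ A A v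
  have key : ∀ a b c : A, a ⊗ₜ[ℂ] LinearMap.mul' ℂ A (T.t₁.symm (b ⊗ₜ c)) =
      LinearMap.mul' ℂ A (T.t₂.symm (a ⊗ₜ b)) ⊗ₜ[ℂ] c :=
    fun a b c => T.lTensor_mul'_t₁_symm (a ⊗ₜ b) c
  have h1 : ∀ b c, LinearMap.mul' ℂ A (T.t₁.symm (b ⊗ₜ c)) = ε b • c := fun b c => by
    simpa [hv, ε] using congrArg (sliceLeft φ) (key v b c)
  have h2 : ∀ a b, LinearMap.mul' ℂ A (T.t₂.symm (a ⊗ₜ b)) = ε b • a := fun a b => by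
    simpa [hv, h1] using (congrArg (sliceRight φ) (key a b v)).symm
  refine ⟨ε, fun x => ?_, fun x => ?_⟩
  · have : sliceLeft ε = LinearMap.mul' ℂ A ∘ₗ T.t₁.symm.toLinearMap :=
      TensorProduct.ext' fun b c => by simp [h1]
    simp [this]
  · have : sliceRight ε = LinearMap.mul' ℂ A ∘ₗ T.t₂.symm.toLinearMap :=
      TensorProduct.ext' fun b c => by simp [h2]
    simp [this]

/-- On the range of `t₁`, hence everywhere, (ε ⊗ ι)(Δ(a)x) = a(ε ⊗ ι)(x). Applied to Δ(a)(b ⊗ c) =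
(Δ(a)(1 ⊗ c))(b ⊗ 1), this shows that right multiplication by b in the first leg becomes the scalar
ε(b). -/
theorem counit_mul {ε : A →ₗ[ℂ] ℂ} (h : ∀ x, sliceLeft ε (T.t₁ x) = LinearMap.mul' ℂ A x)
    {φ : A →ₗ[ℂ] ℂ} {v : A} (hv : φ v = 1) (a b : A) : ε (a * b) = ε a * ε b := by
  have h1 : ∀ (a : A) (x : A ⊗[ℂ] A), sliceLeft ε ((Δ a).lmul x) = a * sliceLeft ε x := by
    intro a x
    obtain ⟨x, rfl⟩ := T.t₁.surjective x
    induction x with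
    | zero => simp
    | add x y hx hy => simp only [map_add, mul_add, hx, hy]
    | tmul b c => rw [comul_lmul_t₁, h, h]; simp [mul_assoc]
  have h2 : ∀ (b : A) (x : A ⊗[ℂ] A), sliceLeft ε ((leg₁ b).rmul x) = ε b • sliceLeft ε x := by
    intro b x
    obtain ⟨x, rfl⟩ := T.t₁.surjective x
    induction x with
    | zero => simp
    | add x y hx hy => simp only [map_add, smul_add, hx, hy]
    | tmul a c => rw [← comul_lmul_tmul, h1, h]; simp [mul_smul_comm]
  have := congrArg φ (h2 b (a ⊗ₜ v))
  simpa [hv, mul_comm] using this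

theorem isCounit {ε : A →ₗ[ℂ] ℂ} (h₁ : ∀ x, sliceLeft ε (T.t₁ x) = LinearMap.mul' ℂ A x)
    (h₂ : ∀ x, sliceRight ε (T.t₂ x) = LinearMap.mul' ℂ A x)
    {φ : A →ₗ[ℂ] ℂ} {v : A} (hv : φ v = 1) : IsCounit Δ ε where
  map_mul := T.counit_mul h₁ hv
  left_lmul a b := by rw [T.toAlgebra_t₁, h₁]; rfl
  left_rmul a b := by
    rw [T.toAlgebra_t₄]
    -- The two counit equations not given directly by `t₁` and `t₂` follow by multiplying with `c`
    -- on the free side.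
    refine sub_eq_zero.1 (T.nondegenerate.eq_zero_of_mul_right _ fun c => ?_)
    rw [sub_mul, ← sliceLeft_leg₂_rmul, ← leg₂_lmul_t₁, sliceLeft_leg₂_lmul, h₁]
    simp [mul_assoc]
  right_lmul a b := by
    rw [T.toAlgebra_t₃]
    refine sub_eq_zero.1 (T.nondegenerate.eq_zero_of_mul_left _ fun c => ?_)
    rw [mul_sub, ← sliceRight_leg₁_lmul, leg₁_lmul_t₃, sliceRight_leg₁_rmul, h₂]
    simp [mul_assoc]
  right_rmul a b := by rw [T.toAlgebra_t₂, h₂]; rfl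

/-! ### Consequences of left invariance -/

section Integral

variable {ε φ : A →ₗ[ℂ] ℂ}

/-- Coassociativity: both sides are da₁ ⊗ (ι ⊗ φ)(Δ(a₂)x). The factor d keeps everything inside A ⊗
A. -/
theorem leg₁_lmul_t₁_slice (a d : A) (x : A ⊗[ℂ] A) :
    (leg₁ d).lmul (T.t₁ (TensorProduct.comm ℂ A A
      ((sliceRight φ ∘ₗ T.t₁.toLinearMap ∘ₗ TensorProduct.mk ℂ A A a).lTensor A x))) =
      (sliceComulMul Δ φ x).lTensor A (T.t₂ (d ⊗ₜ a)) := by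
  induction x with
  | zero => simp
  | add x y hx hy => simp only [map_add, LinearMap.lTensor_add, LinearMap.add_apply, hx, hy]
  | tmul u v =>
    have h1 : ∀ y : A ⊗[ℂ] A, T.t₂ (d ⊗ₜ sliceRight φ y) = (sliceRight φ).lTensor A
        (TensorProduct.assoc ℂ A A A
          ((T.t₂.toLinearMap ∘ₗ TensorProduct.mk ℂ A A d).rTensor A y)) := by
      intro y
      induction y with
      | zero => simp
      | add x y hx hy => simp only [map_add, TensorProduct.tmul_add, hx, hy]
      | tmul b c => simp [lTensor_sliceRight_assoc_tmul, TensorProduct.tmul_smul]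
    have h2 : LinearMap.mulRight ℂ u ∘ₗ sliceRight φ ∘ₗ
        (T.t₁.toLinearMap ∘ₗ (TensorProduct.mk ℂ A A).flip v) = sliceComulMul Δ φ (u ⊗ₜ v) := by
      ext w
      simp [sliceComulMul, T.comul_lmul_tmul, sliceRight_leg₁_rmul]
    rw [← h2, ← leg₂_rmul_lTensor, LinearMap.lTensor_comp_apply _ (sliceRight φ)
      (T.t₁.toLinearMap ∘ₗ (TensorProduct.mk ℂ A A).flip v), ← T.coassoc₁₂, ← h1,
      LinearMap.lTensor_tmul, TensorProduct.comm_tmul, leg₁_lmul_t₁]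
    rfl

/-- This is a₁ ⊗ a₂b₁c φ(a₃b₂) = a₁φ(a₂b) ⊗ c, that is, left invariance applied to the product a₂b.
-/
theorem t₁_slice (hφ : IsLeftIntegral Δ φ) (a b c : A) :
    T.t₁ (TensorProduct.comm ℂ A A
      ((sliceRight φ ∘ₗ T.t₁.toLinearMap ∘ₗ TensorProduct.mk ℂ A A a).lTensor A
        (T.t₃ (b ⊗ₜ c)))) = sliceRight φ (T.t₁ (a ⊗ₜ b)) ⊗ₜ c := by
  refine sub_eq_zero.1 (eq_zero_of_leg₁_lmul T.nondegenerate _ fun d => ?_)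
  have h1 : ∀ z : A ⊗[ℂ] A, (sliceComulMul Δ φ (T.t₃ (b ⊗ₜ c))).lTensor A z =
      sliceRight φ ((leg₂ b).rmul z) ⊗ₜ c := by
    intro z
    induction z with
    | zero => simp
    | add x y hx hy => simp only [map_add, TensorProduct.add_tmul, hx, hy]
    | tmul y w =>
      have : sliceComulMul Δ φ (T.t₃ (b ⊗ₜ c)) w = φ (w * b) • c := by
        rw [← hφ.lmul, T.toAlgebra_t₃, ← comul_lmul_t₃]
        rfl
      simp [this, TensorProduct.smul_tmul]
  rw [map_sub, leg₁_lmul_t₁_slice, h1, ← leg₁_lmul_t₁, sliceRight_leg₁_lmul, leg₁_lmul, sub_self]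

/-- The antipode formula `S((ι ⊗ φ)(Δ(a)(1 ⊗ b))) = (ι ⊗ φ)((1 ⊗ a)Δ(b))`, for the left
multiplier `S(p) = (ε ⊗ ι) t₁⁻¹(p ⊗ ·)`. -/
theorem sliceLeft_t₁_symm (hε : IsCounit Δ ε) (hφ : IsLeftIntegral Δ φ) (y : A ⊗[ℂ] A) (c : A) :
    sliceLeft ε (T.t₁.symm (sliceRight φ (T.t₁ y) ⊗ₜ c)) = sliceRight φ (T.t₄ y) * c := by
  induction y with
  | zero => simp
  | add x y hx hy => simp only [map_add, TensorProduct.add_tmul, add_mul, hx, hy]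
  | tmul a b =>
    rw [← t₁_slice T hφ, LinearEquiv.symm_apply_apply, ← sliceRight_leg₁_rmul, ← leg₂_lmul_t₃]
    induction T.t₃ (b ⊗ₜ c) with
    | zero => simp
    | add x y hx hy => simp only [map_add, hx, hy]
    | tmul u v =>
      -- The counit removes the first leg of Δ(a).
      have : ε (sliceRight φ (T.t₁ (a ⊗ₜ v))) = φ (a * v) := by
        rw [← apply_sliceLeft, ← hε.left_lmul, T.toAlgebra_t₁]
      simp [this]

theorem leg₁_rmul_t₄_slice (b d : A) (x : A ⊗[ℂ] A) :
    (leg₁ d).rmul (T.t₄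
      ((sliceRight φ ∘ₗ T.t₄.toLinearMap ∘ₗ (TensorProduct.mk ℂ A A).flip b).lTensor A x)) =
      (sliceMulComul Δ φ x).lTensor A (T.t₃ (b ⊗ₜ d)) := by
  induction x with
  | zero => simp
  | add x y hx hy => simp only [map_add, LinearMap.lTensor_add, LinearMap.add_apply, hx, hy]
  | tmul u v =>
    have h1 : ∀ y : A ⊗[ℂ] A, T.t₃ (sliceRight φ y ⊗ₜ d) = (sliceRight φ).lTensor A
        (TensorProduct.assoc ℂ A A A
          ((T.t₃.toLinearMap ∘ₗ (TensorProduct.mk ℂ A A).flip d).rTensor A y)) := by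
      intro y
      induction y with
      | zero => simp
      | add x y hx hy => simp only [map_add, TensorProduct.add_tmul, hx, hy]
      | tmul b c => simp [lTensor_sliceRight_assoc_tmul, ← TensorProduct.smul_tmul']
    have h2 : LinearMap.mulLeft ℂ u ∘ₗ sliceRight φ ∘ₗ
        (T.t₄.toLinearMap ∘ₗ TensorProduct.mk ℂ A A v) = sliceMulComul Δ φ (u ⊗ₜ v) := by
      ext w
      simp [sliceMulComul, T.comul_rmul_tmul, sliceRight_leg₁_lmul]
    rw [← h2, ← leg₂_lmul_lTensor, LinearMap.lTensor_comp_apply _ (sliceRight φ)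
      (T.t₄.toLinearMap ∘ₗ TensorProduct.mk ℂ A A v), T.coassoc₃₄, ← h1,
      LinearMap.lTensor_tmul, ← leg₂_lmul_t₃]
    rfl

/-- Mirror image of `t₁_slice`: b₁ ⊗ ca₁b₂ φ(a₂b₃) = b₁φ(ab₂) ⊗ c. -/
theorem t₄_slice (hφ : IsLeftIntegral Δ φ) (a b c : A) :
    T.t₄ ((sliceRight φ ∘ₗ T.t₄.toLinearMap ∘ₗ (TensorProduct.mk ℂ A A).flip b).lTensor A
        (T.t₂ (c ⊗ₜ a))) = sliceRight φ (T.t₄ (a ⊗ₜ b)) ⊗ₜ c := by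
  refine sub_eq_zero.1 (eq_zero_of_leg₁_rmul T.nondegenerate _ fun d => ?_)
  have h1 : ∀ z : A ⊗[ℂ] A, (sliceMulComul Δ φ (T.t₂ (c ⊗ₜ a))).lTensor A z =
      sliceRight φ ((leg₂ a).lmul z) ⊗ₜ c := by
    intro z
    induction z with
    | zero => simp
    | add x y hx hy => simp only [map_add, TensorProduct.add_tmul, hx, hy]
    | tmul y w =>
      have : sliceMulComul Δ φ (T.t₂ (c ⊗ₜ a)) w = φ (a * w) • c := by
        rw [← hφ.rmul, T.toAlgebra_t₂, ← comul_rmul_t₂]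
        rfl
      simp [this, TensorProduct.smul_tmul]
  rw [map_sub, leg₁_rmul_t₄_slice, h1, leg₂_lmul_t₃, sliceRight_leg₁_rmul, leg₁_rmul, sub_self]

/-- The formula for the inverse of the antipode, mirror image of `sliceLeft_t₁_symm`. -/
theorem sliceRight_t₄_symm (hε : IsCounit Δ ε) (hφ : IsLeftIntegral Δ φ) (y : A ⊗[ℂ] A) (c : A) :
    sliceRight ε (T.t₄.symm (sliceRight φ (T.t₄ y) ⊗ₜ c)) = c * sliceRight φ (T.t₁ y) := by
  induction y with
  | zero => simp
  | add x y hx hy => simp only [map_add, TensorProduct.add_tmul, mul_add, hx, hy]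
  | tmul a b =>
    rw [← t₄_slice T hφ, LinearEquiv.symm_apply_apply, ← sliceRight_leg₁_lmul, leg₁_lmul_t₁]
    induction T.t₂ (c ⊗ₜ a) with
    | zero => simp
    | add x y hx hy => simp only [map_add, hx, hy]
    | tmul u v =>
      have : ε (sliceRight φ (T.t₄ (v ⊗ₜ b))) = φ (v * b) := by
        rw [← apply_sliceLeft, ← hε.left_rmul, T.toAlgebra_t₄]
      simp [this]

end Integral

end CanonicalMaps

end CanonicalIdentities

/-! ### Existence and properties of the antipode -/

section Antipode

variable {A : Type*} [NonUnitalRing A] [Module ℂ A] [IsScalarTower ℂ A A] [SMulCommClass ℂ A A]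

variable {Δ : A →ₗ[ℂ] Multiplier (A ⊗[ℂ] A)} {ε φ : A →ₗ[ℂ] ℂ} {S : A →ₗ[ℂ] A}

theorem IsLeftIntegral.exists_apply_eq_one (hφ : IsLeftIntegral Δ φ) : ∃ v, φ v = 1 := by
  obtain ⟨w, hw⟩ := DFunLike.ne_iff.1 hφ.ne_zero
  exact ⟨(φ w)⁻¹ • w, by simpa using inv_mul_cancel₀ hw⟩

namespace CanonicalMaps

theorem sliceLeft_t₁ (T : CanonicalMaps Δ) (hε : IsCounit Δ ε) (x : A ⊗[ℂ] A) :
    sliceLeft ε (T.t₁ x) = LinearMap.mul' ℂ A x := by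
  induction x with
  | zero => simp
  | add x y hx hy => simp only [map_add, hx, hy]
  | tmul a b => rw [← T.toAlgebra_t₁, hε.left_lmul]; rfl

theorem sliceRight_t₂ (T : CanonicalMaps Δ) (hε : IsCounit Δ ε) (x : A ⊗[ℂ] A) :
    sliceRight ε (T.t₂ x) = LinearMap.mul' ℂ A x := by
  induction x with
  | zero => simp
  | add x y hx hy => simp only [map_add, hx, hy]
  | tmul a b => rw [← T.toAlgebra_t₂, hε.right_rmul]; rfl

/-- The first antipode axiom reads m(S ⊗ ι)t₁ = ε ⊗ ι, and `t₁` is invertible. In particular S is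
determined by ε. -/
theorem antipode_mul (T : CanonicalMaps Δ) (hS : IsHopfAntipode Δ ε S) (a c : A) :
    S a * c = sliceLeft ε (T.t₁.symm (a ⊗ₜ c)) := by
  have h : ∀ x, LinearMap.mul' ℂ A (S.rTensor A (T.t₁ x)) = sliceLeft ε x := by
    intro x
    induction x with
    | zero => simp
    | add x y hx hy => simp only [map_add, hx, hy]
    | tmul a b => rw [← T.toAlgebra_t₁, hS.left, sliceLeft_tmul]
  rw [← h, LinearEquiv.apply_symm_apply]
  rfl

/-- Both sides are to become aS(b)c, which yields the second antipode axiom from the first. With y =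
t₁⁻¹(b ⊗ c) and u = (t₂⁻¹ ⊗ ι)(a ⊗ y), the triple product of u is computed in two ways: via m = (ε ⊗
ι)t₁ on the last two legs and via m t₂⁻¹ = ι ⊗ ε on the first two. -/
theorem sliceRight_t₂_symm_mul (T : CanonicalMaps Δ) (hε : IsCounit Δ ε) (a b c : A) :
    sliceRight ε (T.t₂.symm (a ⊗ₜ b)) * c = a * sliceLeft ε (T.t₁.symm (b ⊗ₜ c)) := by
  set y := T.t₁.symm (b ⊗ₜ c) with hy
  set u := T.t₂.symm.toLinearMap.rTensor A ((TensorProduct.assoc ℂ A A A).symm (a ⊗ₜ y)) with hu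
  have hcancel : ∀ w : (A ⊗[ℂ] A) ⊗[ℂ] A,
      T.t₂.toLinearMap.rTensor A (T.t₂.symm.toLinearMap.rTensor A w) = w := by
    intro w
    rw [← LinearMap.rTensor_comp_apply]
    simp
  have hcancel' : ∀ w : (A ⊗[ℂ] A) ⊗[ℂ] A,
      T.t₂.symm.toLinearMap.rTensor A (T.t₂.toLinearMap.rTensor A w) = w := by
    intro w
    rw [← LinearMap.rTensor_comp_apply]
    simp
  have h1 := T.lTensor_t₁_rTensor_t₂ u
  rw [hu, hcancel, LinearEquiv.apply_symm_apply, ← hu, LinearMap.lTensor_tmul,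
    LinearEquiv.coe_coe, hy, LinearEquiv.apply_symm_apply, ← TensorProduct.assoc_tmul] at h1
  have h2 := congrArg (T.t₂.symm.toLinearMap.rTensor A)
    ((TensorProduct.assoc ℂ A A A).injective h1)
  rw [hcancel', LinearMap.rTensor_tmul, LinearEquiv.coe_coe] at h2
  have h3 := ((LinearEquiv.symm_apply_eq _).1 h2.symm)
  have e1 : LinearMap.mul' ℂ A = sliceLeft ε ∘ₗ T.t₁.toLinearMap :=
    LinearMap.ext fun x => (T.sliceLeft_t₁ hε x).symm
  have e2 : LinearMap.mul' ℂ A ∘ₗ T.t₂.symm.toLinearMap = sliceRight ε :=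
    LinearMap.ext fun x => by simp [← T.sliceRight_t₂ hε]
  have h4 : LinearMap.mul' ℂ A ((LinearMap.mul' ℂ A).lTensor A (TensorProduct.assoc ℂ A A A u)) =
      sliceRight ε (T.t₂.symm (a ⊗ₜ b)) * c := by
    conv_lhs => enter [2, 1]; rw [e1]
    rw [LinearMap.lTensor_comp_apply, h3, lTensor_sliceLeft_assoc_tmul]
    rfl
  have h5 : ∀ u : (A ⊗[ℂ] A) ⊗[ℂ] A,
      LinearMap.mul' ℂ A ((LinearMap.mul' ℂ A).lTensor A (TensorProduct.assoc ℂ A A A u)) =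
      LinearMap.mul' ℂ A ((LinearMap.mul' ℂ A).rTensor A u) := by
    intro u
    induction u with
    | zero => simp
    | add x y hx hy => simp only [map_add, hx, hy]
    | tmul x c =>
      induction x with
      | zero => simp
      | add x y hx hy => simp only [map_add, TensorProduct.add_tmul, hx, hy]
      | tmul a b => simp [mul_assoc]
  rw [← h4, h5, hu, ← LinearMap.rTensor_comp_apply, e2]
  clear_value y
  clear hy hu h1 h2 h3 h4 h5 u
  induction y with
  | zero => simp
  | add x y hx hy => simp only [map_add, TensorProduct.tmul_add, mul_add, hx, hy]
  | tmul x y => simp [smul_mul_assoc, mul_smul_comm]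

theorem exists_antipode (T : CanonicalMaps Δ) (hε : IsCounit Δ ε) (hφ : IsLeftIntegral Δ φ) :
    ∃ S : A →ₗ[ℂ] A, IsHopfAntipode Δ ε S := by
  obtain ⟨v, hv⟩ := hφ.exists_apply_eq_one
  -- As φ(v) = 1, p is the slice (ι ⊗ φ)(t₁ y) with y = t₁⁻¹(p ⊗ v); formula (1) then dictates S(p)
  -- = (ι ⊗ φ)(t₄ y).
  let S : A →ₗ[ℂ] A := sliceRight φ ∘ₗ T.t₄.toLinearMap ∘ₗ T.t₁.symm.toLinearMap ∘ₗ
    (TensorProduct.mk ℂ A A).flip v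
  have hS : ∀ a c, S a * c = sliceLeft ε (T.t₁.symm (a ⊗ₜ c)) := by
    intro a c
    have := T.sliceLeft_t₁_symm hε hφ (T.t₁.symm (a ⊗ₜ v)) c
    rw [LinearEquiv.apply_symm_apply, sliceRight_tmul, hv, one_smul] at this
    exact this.symm
  have hl : ∀ x, LinearMap.mul' ℂ A (S.rTensor A x) = sliceLeft ε (T.t₁.symm x) := by
    intro x
    induction x with
    | zero => simp
    | add x y hx hy => simp only [map_add, hx, hy]
    | tmul a c => exact hS a c
  have hr : ∀ x, LinearMap.mul' ℂ A (S.lTensor A x) = sliceRight ε (T.t₂.symm x) := by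
    intro x
    induction x with
    | zero => simp
    | add x y hx hy => simp only [map_add, hx, hy]
    | tmul a b =>
      refine sub_eq_zero.1 (T.nondegenerate.eq_zero_of_mul_right _ fun c => ?_)
      rw [sub_mul, T.sliceRight_t₂_symm_mul hε, ← hS]
      simp [mul_assoc]
  refine ⟨S, fun a b => ?_, fun a b => ?_⟩
  · rw [T.toAlgebra_t₁, hl, LinearEquiv.symm_apply_apply, sliceLeft_tmul]
  · rw [T.toAlgebra_t₂, hr, LinearEquiv.symm_apply_apply, sliceRight_tmul]

theorem antipode_slice (T : CanonicalMaps Δ) (hε : IsCounit Δ ε) (hφ : IsLeftIntegral Δ φ)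
    (hS : IsHopfAntipode Δ ε S) (y : A ⊗[ℂ] A) :
    S (sliceRight φ (T.t₁ y)) = sliceRight φ (T.t₄ y) := by
  refine sub_eq_zero.1 (T.nondegenerate.eq_zero_of_mul_right _ fun c => ?_)
  rw [sub_mul, T.antipode_mul hS, T.sliceLeft_t₁_symm hε hφ, sub_self]

/-- Multiplicativity of Δ and ε enters here: if b ⊗ q = Σ t₁(r ⊗ s), then Δ(p)(b ⊗ q) = Σ t₁(pr ⊗
s), and ε(pr)s sums to ε(p)S(b)q. -/
theorem antipode_anti_mul (T : CanonicalMaps Δ) (hε : IsCounit Δ ε) (hS : IsHopfAntipode Δ ε S)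
    (a b : A) :
    S (a * b) = S b * S a := by
  refine sub_eq_zero.1 (T.nondegenerate.eq_zero_of_mul_right _ fun c => ?_)
  have hcomul : ∀ p (z : A ⊗[ℂ] A), (Δ p).lmul (T.t₁ z) =
      T.t₁ ((LinearMap.mulLeft ℂ p).rTensor A z) := by
    intro p z
    induction z with
    | zero => simp
    | add x y hx hy => simp only [map_add, hx, hy]
    | tmul r s => simp [comul_lmul_t₁]
  have key : ∀ z : A ⊗[ℂ] A, sliceLeft ε (T.t₁.symm ((leg₁ b).rmul (T.t₁ z))) =
      S b * sliceLeft ε z := by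
    intro z
    induction z with
    | zero => simp
    | add x y hx hy => simp only [map_add, mul_add, hx, hy]
    | tmul p q =>
      rw [← T.comul_lmul_tmul, sliceLeft_tmul, mul_smul_comm, T.antipode_mul hS]
      conv_lhs => rw [← T.t₁.apply_symm_apply (b ⊗ₜ[ℂ] q)]
      rw [hcomul, LinearEquiv.symm_apply_apply]
      induction T.t₁.symm (b ⊗ₜ[ℂ] q) with
      | zero => simp
      | add x y hx hy => simp only [map_add, smul_add, hx, hy]
      | tmul r s => simp [hε.map_mul, mul_smul]
  have := key (T.t₁.symm (a ⊗ₜ c))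
  rw [LinearEquiv.apply_symm_apply, leg₁_rmul, ← T.antipode_mul hS, ← T.antipode_mul hS,
    ← mul_assoc] at this
  rw [sub_mul, this, sub_self]

theorem isAntipodeRelativeTo (T : CanonicalMaps Δ) (hε : IsCounit Δ ε) (hφ : IsLeftIntegral Δ φ)
    (hS : IsHopfAntipode Δ ε S) : IsAntipodeRelativeTo Δ φ S where
  bijective := by
    obtain ⟨v, hv⟩ := hφ.exists_apply_eq_one
    constructor
    · refine (injective_iff_map_eq_zero S).2 fun p hp => ?_
      -- Every p is such a slice, and `sliceRight_t₄_symm` recovers c p from S(p) = 0.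
      have h : sliceRight φ (T.t₁ (T.t₁.symm (p ⊗ₜ v))) = p := by simp [hv]
      have h' := T.antipode_slice hε hφ hS (T.t₁.symm (p ⊗ₜ v))
      rw [h, hp] at h'
      refine T.nondegenerate.eq_zero_of_mul_left _ fun c => ?_
      rw [← h, ← T.sliceRight_t₄_symm hε hφ, ← h']
      simp
    · intro b
      exact ⟨_, (T.antipode_slice hε hφ hS (T.t₄.symm (b ⊗ₜ v))).trans (by simp [hv])⟩
  map_mul := T.antipode_anti_mul hε hS
  apply_slice a b := by rw [T.toAlgebra_t₁, T.toAlgebra_t₄, T.antipode_slice hε hφ hS]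

/-! ### Faithfulness of left integrals -/

theorem sliceRight_t₁_eq_zero (T : CanonicalMaps Δ) {a : A} (ha : ∀ b, φ (b * a) = 0) (b : A) :
    sliceRight φ (T.t₁ (b ⊗ₜ a)) = 0 := by
  refine T.nondegenerate.eq_zero_of_mul_left _ fun d => ?_
  rw [← sliceRight_leg₁_lmul, leg₁_lmul_t₁]
  induction T.t₂ (d ⊗ₜ b) with
  | zero => simp
  | add x y hx hy => simp [hx, hy]
  | tmul x y => simp [ha]

theorem sliceRight_t₄_eq_zero (T : CanonicalMaps Δ) {a : A} (ha : ∀ b, φ (a * b) = 0) (b : A) :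
    sliceRight φ (T.t₄ (a ⊗ₜ b)) = 0 := by
  refine T.nondegenerate.eq_zero_of_mul_right _ fun d => ?_
  rw [← sliceRight_leg₁_rmul, ← leg₂_lmul_t₃]
  induction T.t₃ (b ⊗ₜ d) with
  | zero => simp
  | add x y hx hy => simp [hx, hy]
  | tmul x y => simp [ha]

/-- Otherwise all slices (ι ⊗ φ)(t₁ x) vanish, although surjectivity of `t₁` makes v one of them. -/
theorem exists_integral_mul_ne_zero (T : CanonicalMaps Δ) (hφ : IsLeftIntegral Δ φ) :
    ∃ c d, φ (c * d) ≠ 0 := by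
  by_contra! h
  obtain ⟨v, hv⟩ := hφ.exists_apply_eq_one
  have h1 : ∀ x, sliceRight φ (T.t₁ x) = 0 := by
    intro x
    induction x with
    | zero => simp
    | add x y hx hy => simp [hx, hy]
    | tmul a b => exact T.sliceRight_t₁_eq_zero (fun c => h c b) a
  have h2 := h1 (T.t₁.symm (v ⊗ₜ v))
  rw [LinearEquiv.apply_symm_apply, sliceRight_tmul, hv, one_smul] at h2
  simp [h2] at hv

/-- In Sweedler notation S(a₁e)a₂ = S(e)S(a₁)a₂ = ε(a)S(e); the factor c brings in `t₁`, where the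
antipode axiom applies. -/
theorem mul'_rTensor_antipode_t₃ (T : CanonicalMaps Δ) (hS : IsHopfAntipode Δ ε S)
    (hmul : ∀ a b, S (a * b) = S b * S a) (a e : A) :
    LinearMap.mul' ℂ A (S.rTensor A (T.t₃ (a ⊗ₜ e))) = ε a • S e := by
  refine sub_eq_zero.1 (T.nondegenerate.eq_zero_of_mul_right _ fun c => ?_)
  have h1 : ∀ x : A ⊗[ℂ] A, LinearMap.mul' ℂ A (S.rTensor A x) * c =
      LinearMap.mul' ℂ A (S.rTensor A ((leg₂ c).rmul x)) := by
    intro x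
    induction x with
    | zero => simp
    | add x y hx hy => simp only [map_add, add_mul, hx, hy]
    | tmul a b => simp [mul_assoc]
  have h2 : ∀ x : A ⊗[ℂ] A, LinearMap.mul' ℂ A (S.rTensor A ((leg₁ e).rmul x)) =
      S e * LinearMap.mul' ℂ A (S.rTensor A x) := by
    intro x
    induction x with
    | zero => simp
    | add x y hx hy => simp only [map_add, mul_add, hx, hy]
    | tmul a b => simp [hmul, mul_assoc]
  rw [sub_mul, h1, ← leg₁_rmul_t₁, h2, ← T.toAlgebra_t₁, hS.left, mul_smul_comm, smul_mul_assoc,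
    sub_self]

theorem eq_zero_of_integral_mul_left (T : CanonicalMaps Δ) (hε : IsCounit Δ ε) (hφ :
    IsLeftIntegral Δ φ)
    (hS : IsHopfAntipode Δ ε S) {a : A} (ha : ∀ b, φ (b * a) = 0) : a = 0 := by
  have hR := T.isAntipodeRelativeTo hε hφ hS
  let β : A →ₗ[ℂ] A →ₗ[ℂ] ℂ := (LinearMap.mul ℂ A).flip.compr₂ φ
  have hβ : ∀ n b, β n b = φ (b * n) := fun n b => rfl
  -- The second legs of Δ(a)(e ⊗ 1) stay in the kernel: formula (1) converts the vanishing of (ι ⊗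
  -- φ)(Δ(b)(1 ⊗ a)) into that of (ι ⊗ φ)((1 ⊗ b)Δ(a)).
  have hslice : ∀ a, (∀ b, φ (b * a) = 0) → ∀ e (ω : A →ₗ[ℂ] ℂ) (b : A),
      φ (b * sliceLeft ω (T.t₃ (a ⊗ₜ e))) = 0 := by
    intro a ha e ω b
    rw [← sliceLeft_leg₂_lmul, apply_sliceLeft, leg₂_lmul_t₃, sliceRight_leg₁_rmul,
      ← T.antipode_slice hε hφ hS, T.sliceRight_t₁_eq_zero ha, map_zero, zero_mul, map_zero]
  have hker : ∀ a, (∀ b, φ (b * a) = 0) → ε a = 0 := by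
    intro a ha
    obtain ⟨c, d, hcd⟩ := T.exists_integral_mul_ne_zero hφ
    obtain ⟨e, rfl⟩ := hR.bijective.2 d
    -- The contraction is φ(cS(a₁e)a₂) = ε(a)φ(cS(e)), where e was chosen so that φ(cS(e)) ≠ 0.
    have h1 := lift_eq_zero_of_sliceLeft β (T.t₃ (a ⊗ₜ e))
      (fun ω => LinearMap.ext fun b => hslice a ha e ω b) (LinearMap.mulLeft ℂ c ∘ₗ S)
    have h2 : ∀ x : A ⊗[ℂ] A, TensorProduct.lift (β.flip ∘ₗ (LinearMap.mulLeft ℂ c ∘ₗ S)) x =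
        φ (c * LinearMap.mul' ℂ A (S.rTensor A x)) := by
      intro x
      induction x with
      | zero => simp
      | add x y hx hy => simp only [map_add, mul_add, hx, hy]
      | tmul x y => simp [hβ, mul_assoc]
    rw [h2, T.mul'_rTensor_antipode_t₃ hS hR.map_mul, mul_smul_comm, map_smul, smul_eq_mul] at h1
    exact (mul_eq_zero.1 h1).resolve_right hcd
  refine T.nondegenerate.eq_zero_of_mul_right _ fun e => ?_
  rw [← hε.right_lmul, T.toAlgebra_t₃]
  exact sliceRight_eq_zero_of_sliceLeft ε _ fun ω => hker _ (hslice a ha e ω)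

theorem eq_zero_of_integral_mul_right (T : CanonicalMaps Δ) (hε : IsCounit Δ ε) (hφ :
    IsLeftIntegral Δ φ)
    (hS : IsHopfAntipode Δ ε S) {a : A} (ha : ∀ b, φ (a * b) = 0) : a = 0 := by
  have hR := T.isAntipodeRelativeTo hε hφ hS
  let σ := LinearEquiv.ofBijective S hR.bijective
  have hσ : ∀ x, S (σ.symm x) = x := σ.apply_symm_apply
  let β : A →ₗ[ℂ] A →ₗ[ℂ] ℂ := (LinearMap.mul ℂ A).compr₂ φ
  have hβ : ∀ n b, β n b = φ (n * b) := fun n b => rfl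
  have hslice : ∀ a, (∀ b, φ (a * b) = 0) → ∀ e (ω : A →ₗ[ℂ] ℂ) (b : A),
      φ (sliceLeft ω (T.t₂ (e ⊗ₜ a)) * b) = 0 := by
    intro a ha e ω b
    -- Here (1) is used backwards, through injectivity of S.
    have h0 : sliceRight φ (T.t₁ (a ⊗ₜ b)) = 0 := by
      apply hR.bijective.1
      rw [T.antipode_slice hε hφ hS, T.sliceRight_t₄_eq_zero ha, map_zero]
    rw [← sliceLeft_leg₂_rmul, apply_sliceLeft, ← leg₁_lmul_t₁, sliceRight_leg₁_lmul, h0,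
      mul_zero, map_zero]
  have hker : ∀ a, (∀ b, φ (a * b) = 0) → ε a = 0 := by
    intro a ha
    obtain ⟨d, c, hcd⟩ := T.exists_integral_mul_ne_zero hφ
    -- With e = S(d), the contraction is φ(a₂S⁻¹(ea₁)c) = φ(S⁻¹(ea₁S(a₂))c) = ε(a)φ(dc).
    have h1 := lift_eq_zero_of_sliceLeft β (T.t₂ (S d ⊗ₜ a))
      (fun ω => LinearMap.ext fun b => hslice a ha (S d) ω b)
      (LinearMap.mulRight ℂ c ∘ₗ σ.symm.toLinearMap)
    have h2 : ∀ x : A ⊗[ℂ] A,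
        TensorProduct.lift (β.flip ∘ₗ (LinearMap.mulRight ℂ c ∘ₗ σ.symm.toLinearMap)) x =
        φ (σ.symm (LinearMap.mul' ℂ A (S.lTensor A x)) * c) := by
      intro x
      induction x with
      | zero => simp
      | add x y hx hy => simp only [map_add, add_mul, hx, hy]
      | tmul x y =>
        have : σ.symm (x * S y) = y * σ.symm x := by
          apply hR.bijective.1
          rw [hσ, hR.map_mul, hσ]
        simp [hβ, mul_assoc, this]
    have h3 : σ.symm (S d) = d := σ.symm_apply_apply d
    rw [h2, ← T.toAlgebra_t₂, hS.right, map_smul, h3, smul_mul_assoc, map_smul, smul_eq_mul] at h1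
    exact (mul_eq_zero.1 h1).resolve_right hcd
  refine T.nondegenerate.eq_zero_of_mul_left _ fun e => ?_
  rw [← hε.right_rmul, T.toAlgebra_t₂]
  exact sliceRight_eq_zero_of_sliceLeft ε _ fun ω => hker _ (hslice a ha e ω)

end CanonicalMaps

end Antipode

end QHyper

theorem proposition1p14 {A : Type*} [NonUnitalRing A] [Module ℂ A] [IsScalarTower ℂ A A]
    [SMulCommClass ℂ A A] (Δ : A →ₗ[ℂ] QHyper.Multiplier (TensorProduct ℂ A A))
    (h : QHyper.IsAlgebraicQuantumGroup Δ) :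
    QHyper.IsAlgebraicQuantumHypergroup Δ ∧
      (∃ (ε : A →ₗ[ℂ] ℂ) (S : A →ₗ[ℂ] A),
        QHyper.IsCounit Δ ε ∧ QHyper.IsHopfAntipode Δ ε S) ∧
      ∀ (ε : A →ₗ[ℂ] ℂ) (S : A →ₗ[ℂ] A) (φ : A →ₗ[ℂ] ℂ),
        QHyper.IsCounit Δ ε → QHyper.IsHopfAntipode Δ ε S → QHyper.IsLeftIntegral Δ φ →
          QHyper.IsFaithful φ ∧ QHyper.IsAntipodeRelativeTo Δ φ S := by
  obtain ⟨T⟩ := h.regular.nonempty_canonicalMaps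
  obtain ⟨φ, hφ⟩ := h.exists_integral
  obtain ⟨v, hv⟩ := hφ.exists_apply_eq_one
  obtain ⟨ε, h₁, h₂⟩ := T.exists_counit hv
  have hε := T.isCounit h₁ h₂ hv
  obtain ⟨S, hS⟩ := T.exists_antipode hε hφ
  have main : ∀ (ε : A →ₗ[ℂ] ℂ) (S : A →ₗ[ℂ] A) (φ : A →ₗ[ℂ] ℂ),
      QHyper.IsCounit Δ ε → QHyper.IsHopfAntipode Δ ε S → QHyper.IsLeftIntegral Δ φ →
        QHyper.IsFaithful φ ∧ QHyper.IsAntipodeRelativeTo Δ φ S := by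
    intro ε S φ hε hS hφ
    refine ⟨fun a ha => ?_, T.isAntipodeRelativeTo hε hφ hS⟩
    rcases ha with ha | ha
    · exact T.eq_zero_of_integral_mul_right hε hφ hS ha
    · exact T.eq_zero_of_integral_mul_left hε hφ hS ha
  refine ⟨⟨T.nondegenerate, ⟨h.regular.hopf.comul, ?_, ?_⟩, ⟨ε, hε⟩, φ, hφ, ?_⟩,
    ⟨ε, S, hε, hS⟩, main⟩
  · exact fun a b => ⟨_, T.t₃_spec a b⟩
  · exact fun a b => ⟨_, T.t₄_spec a b⟩
  · exact ⟨(main ε S φ hε hS hφ).1, S, (main ε S φ hε hS hφ).2⟩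

end
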